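/- Let $p,q\ge 0$ and $n=p+q$. A $(p,q)$-clan $\gamma=c_1\cdots c_n$ is an involution of $\{1,\dots,n\}$ (possibly the identity) with each fixed point decorated by $+$ or $-$ so that (number of $+$) $-$ (number of $-$) $=p-q$; here $c_i\in\{+,-\}$ if $i$ is fixed, and $c_i=c_j$ is a natural number, a different one for each pair, if $i\ne j$ are interchanged. For $1\le i\le n$ let $\gamma(i;+)$ (respectively $\gamma(i;-)$) be the number of $+$ signs (respectively $-$ signs) among $c_1,\dots,c_i$ plus the number of pairs of equal natural numbers among $c_1,\dots,c_i$. For $1\le i<j\le n$ let $\gamma(i;j)$ be the number of pairs of equal natural numbers $c_s=c_t$ with $s\le i<j<t$. Let $G=GL_n(\mathbb C)$, let $B\subset G$ be the subgroup of upper triangular matrices, and identify $G/B$, with its Zariski topology, with the variety of complete flags $F_\bullet$ in $\mathbb C^n$. Let $K=GL_p(\mathbb C)\times GL_q(\mathbb C)\subset G$ be the subgroup of block diagonal matrices, $E_p=\langle e_1,\dots,e_p\rangle$, $\widetilde E_q=\langle e_{p+1},\dots,e_n\rangle$, and let $\pi:\mathbb C^n\to E_p$ be the projection with kernel $\widetilde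 E_q$. For a $(p,q)$-clan $\gamma$ let $Q_\gamma$ be the set of all flags $F_\bullet$ such that $$\dim(F_i\cap E_p)=\gamma(i;+),\qquad \dim(F_i\cap\widetilde E_q)=\gamma(i;-),\qquad \dim(\pi(F_i)+F_j)=j+\gamma(i;j)$$ for all $1\le i\le n$ in the first two conditions, and all $1\le i<j\le n$ in the third. Theorem. For every $(p,q)$-clan $\gamma$ the set $Q_\gamma$ is a single (nonempty) $K$-orbit; let $Y_\gamma=\overline{Q_\gamma}$ be its closure in $G/B$. For all $(p,q)$-clans $\gamma,\tau$, one has $Y_\gamma\subseteq Y_\tau$ if and only if 1. $\gamma(i;+)\ge\tau(i;+)$ for all $1\le i\le n$; 2. $\gamma(i;-)\ge\tau(i;-)$ for all $1\le i\le n$; and 3. $\gamma(i;j)\le\tau(i;j)$ for all $1\le i<j\le n$. -/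

import Mathlib

/-- A `(p,q)`-clan: an involution of the `p + q` positions together with a decoration of each of
its fixed points by a sign.  `plus` is the set of fixed points decorated by `+`; all the other
fixed points are decorated by `-`.  Positions are numbered from `0`. -/
structure Clan (p q : ℕ) where
  perm : Equiv.Perm (Fin (p + q))
  perm_perm : ∀ k, perm (perm k) = k
  plus : Finset (Fin (p + q))
  perm_plus : ∀ k ∈ plus, perm k = k
  signature : (plus.card : ℤ) - ((Finset.univ.filter fun k => perm k = k ∧ k ∉ plus).card : ℤ)
    = (p : ℤ) - (q : ℤ)

namespace Clan

variable {p q : ℕ}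

/-- The fixed points decorated by `-`. -/
def minus (γ : Clan p q) : Finset (Fin (p + q)) :=
  Finset.univ.filter fun k => γ.perm k = k ∧ k ∉ γ.plus

/-- The matching pairs of the clan, each listed once, as `(s, t)` with `s < t`. -/
def pairs (γ : Clan p q) : Finset (Fin (p + q) × Fin (p + q)) :=
  Finset.univ.filter fun x => x.1 < x.2 ∧ γ.perm x.1 = x.2

/-- `γ(i; +)`: the number of `+` signs and of matching pairs among the first `i` characters. -/
def plusRank (γ : Clan p q) (i : ℕ) : ℕ :=
  (γ.plus.filter fun k : Fin (p + q) => (k : ℕ) < i).card +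
    (γ.pairs.filter fun x => (x.1 : ℕ) < i ∧ (x.2 : ℕ) < i).card

/-- `γ(i; -)`: the number of `-` signs and of matching pairs among the first `i` characters. -/
def minusRank (γ : Clan p q) (i : ℕ) : ℕ :=
  (γ.minus.filter fun k : Fin (p + q) => (k : ℕ) < i).card +
    (γ.pairs.filter fun x => (x.1 : ℕ) < i ∧ (x.2 : ℕ) < i).card

/-- `γ(i; j)`: the number of matching pairs with one member among the first `i` characters and the
other one beyond the first `j` characters. -/
def pairRank (γ : Clan p q) (i j : ℕ) : ℕ :=
  (γ.pairs.filter fun x => (x.1 : ℕ) < i ∧ j ≤ (x.2 : ℕ)).card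

end Clan

/-- Complete flags `0 = F₀ ⊂ F₁ ⊂ ⋯ ⊂ Fₙ = ℂⁿ` with `dim Fᵢ = i`. -/
@[ext]
structure CompleteFlag (n : ℕ) where
  space : Fin (n + 1) → Submodule ℂ (Fin n → ℂ)
  mono : Monotone space
  finrank_space : ∀ i, Module.finrank ℂ (space i) = (i : ℕ)

namespace CompleteFlag

variable {n : ℕ}

/-- `GLₙ(ℂ)` acts on flags by moving each subspace. -/
instance : MulAction (GL (Fin n) ℂ) (CompleteFlag n) where
  smul g F :=
    { space := fun i => (F.space i).map (Matrix.toLin' (g : Matrix (Fin n) (Fin n) ℂ))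
      mono := fun _ _ h => Submodule.map_mono (F.mono h)
      finrank_space := fun i => by
        have hinj : Function.Injective (Matrix.toLin' (g : Matrix (Fin n) (Fin n) ℂ)) :=
          Matrix.mulVec_injective_of_isUnit g.isUnit
        exact (LinearEquiv.finrank_eq
          (Submodule.equivMapOfInjective _ hinj (F.space i))).symm.trans (F.finrank_space i) }
  one_smul F := by
    ext1
    funext i
    change (F.space i).map (Matrix.toLin' 1) = F.space i
    rw [Matrix.toLin'_one, Submodule.map_id]
  mul_smul g h F := by
    ext1
    funext i
    change (F.space i).map (Matrix.toLin'
        ((g : Matrix (Fin n) (Fin n) ℂ) * (h : Matrix (Fin n) (Fin n) ℂ))) =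
      ((F.space i).map (Matrix.toLin' (h : Matrix (Fin n) (Fin n) ℂ))).map
        (Matrix.toLin' (g : Matrix (Fin n) (Fin n) ℂ))
    rw [Matrix.toLin'_mul, Submodule.map_comp]

/-- The standard flag, whose `i`-th space is spanned by the first `i` standard basis vectors. -/
noncomputable def standard (n : ℕ) : CompleteFlag n where
  space := (Pi.basisFun ℂ (Fin n)).flag
  mono := (Pi.basisFun ℂ (Fin n)).flag_mono
  finrank_space := fun i => by
    have hli := (Pi.basisFun ℂ (Fin n)).linearIndependent
    have h := finrank_span_eq_card (hli.comp (Subtype.val : {k : Fin n // k.castSucc < i} → Fin n)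
      Subtype.val_injective)
    rw [Set.range_comp, Subtype.range_coe_subtype] at h
    change Module.finrank ℂ (Submodule.span ℂ _) = _
    rw [h, Fintype.card_subtype]
    have hi : (i : ℕ) ≤ n := Nat.lt_succ_iff.mp i.isLt
    have hc := Fin.card_filter_val_lt (n := n) (m := (i : ℕ))
    simpa [Fin.lt_def, hi] using hc

end CompleteFlag

/-- The Zariski topology on `GLₙ(ℂ)`: the closed sets are the common zero loci in `GLₙ(ℂ)` of sets
of polynomials in the `n²` matrix entries. -/
@[reducible]
def zariskiGL (n : ℕ) : TopologicalSpace (GL (Fin n) ℂ) :=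
  TopologicalSpace.ofClosed
    {Z | ∃ S : Set (MvPolynomial (Fin n × Fin n) ℂ),
      Z = {g | ∀ f ∈ S, MvPolynomial.eval (fun x => g x.1 x.2) f = 0}}
    ⟨{1}, by ext g; simp⟩
    (by
      intro A hA
      choose S hS using fun Z (hZ : Z ∈ A) => hA hZ
      refine ⟨⋃ (Z) (hZ : Z ∈ A), S Z hZ, ?_⟩
      ext g
      simp only [Set.mem_sInter, Set.mem_iUnion, Set.mem_ofPred_eq]
      constructor
      · rintro h f ⟨Z, hZ, hf⟩
        have := h Z hZ
        rw [hS Z hZ] at this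
        exact this f hf
      · intro h Z hZ
        rw [hS Z hZ]
        exact fun f hf => h f ⟨Z, hZ, hf⟩)
    (by
      rintro _ ⟨S, rfl⟩ _ ⟨T, rfl⟩
      refine ⟨{f | ∃ a ∈ S, ∃ b ∈ T, f = a * b}, ?_⟩
      ext g
      simp only [Set.mem_union, Set.mem_ofPred_eq]
      constructor
      · rintro (h | h) _ ⟨a, ha, b, hb, rfl⟩
        · rw [map_mul, h a ha, zero_mul]
        · rw [map_mul, h b hb, mul_zero]
      · intro h
        by_contra! hc
        obtain ⟨⟨a, ha, ha0⟩, b, hb, hb0⟩ := hc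
        have := h _ ⟨a, ha, b, hb, rfl⟩
        rw [map_mul] at this
        exact (mul_ne_zero ha0 hb0) this)

/-- The Zariski topology on the flag variety `GLₙ/B`: the quotient topology along
`GLₙ → GLₙ/B`, `g ↦ g • (standard flag)`; here `B`, the group of invertible upper triangular
matrices, is the stabilizer of the standard flag. -/
noncomputable instance (n : ℕ) : TopologicalSpace (CompleteFlag n) :=
  TopologicalSpace.coinduced (fun g => g • CompleteFlag.standard n) (zariskiGL n)

/-- The subgroup `K = GL_p × GL_q` of `GL_{p+q}(ℂ)`, embedded as the block diagonal matrices with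
a `p × p` block followed by a `q × q` block. -/
def blockSubgroup (p q : ℕ) : Subgroup (GL (Fin (p + q)) ℂ) where
  carrier := {g | ∀ a b : Fin (p + q), ¬((a : ℕ) < p ↔ (b : ℕ) < p) → g a b = 0}
  one_mem' := by
    intro a b h
    have hab : a ≠ b := by
      rintro rfl
      exact h Iff.rfl
    simp [hab]
  mul_mem' := by
    intro g h hg hh a b hab
    change ((g : Matrix (Fin (p + q)) (Fin (p + q)) ℂ) *
      (h : Matrix (Fin (p + q)) (Fin (p + q)) ℂ)) a b = 0
    rw [Matrix.mul_apply]
    refine Finset.sum_eq_zero fun c _ => ?_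
    by_cases hac : ((a : ℕ) < p ↔ (c : ℕ) < p)
    · rw [hh c b (by rwa [← hac]), mul_zero]
    · rw [hg a c hac, zero_mul]
  inv_mem' := by
    intro g hg
    let D : Matrix (Fin (p + q)) (Fin (p + q)) ℂ :=
      Matrix.diagonal fun k => if (k : ℕ) < p then 1 else 0
    have hcomm : Commute D (g : Matrix _ _ ℂ) := by
      ext a b
      rw [Matrix.diagonal_mul, Matrix.mul_diagonal]
      by_cases hab : ((a : ℕ) < p ↔ (b : ℕ) < p)
      · simp only [hab, mul_comm]
      · rw [hg a b hab, mul_zero, zero_mul]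
    have hinv : D * (↑g⁻¹ : Matrix _ _ ℂ) = (↑g⁻¹ : Matrix _ _ ℂ) * D :=
      hcomm.units_inv_right
    intro a b hab
    have h := congrFun (congrFun hinv a) b
    rw [Matrix.diagonal_mul, Matrix.mul_diagonal] at h
    by_cases ha : (a : ℕ) < p <;> by_cases hb : (b : ℕ) < p <;> simp_all

/-- `E_p`, the span of the first `p` standard basis vectors of `ℂ^{p+q}`. -/
def firstSpace (p q : ℕ) : Submodule ℂ (Fin (p + q) → ℂ) :=
  Submodule.span ℂ {v | ∃ k : Fin (p + q), (k : ℕ) < p ∧ v = Pi.single k 1}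

/-- `Ẽ_q`, the span of the last `q` standard basis vectors of `ℂ^{p+q}`. -/
def lastSpace (p q : ℕ) : Submodule ℂ (Fin (p + q) → ℂ) :=
  Submodule.span ℂ {v | ∃ k : Fin (p + q), p ≤ (k : ℕ) ∧ v = Pi.single k 1}

/-- The projection of `ℂ^{p+q}` onto `E_p` with kernel `Ẽ_q`. -/
def firstProj (p q : ℕ) : (Fin (p + q) → ℂ) →ₗ[ℂ] (Fin (p + q) → ℂ) where
  toFun v k := if (k : ℕ) < p then v k else 0
  map_add' v w := by
    ext k
    by_cases hk : (k : ℕ) < p <;> simp [hk]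
  map_smul' c v := by
    ext k
    by_cases hk : (k : ℕ) < p <;> simp [hk]

/-- The set `Q_γ` of flags attached to the clan `γ`.  (For `i = 0` the conditions hold for every
flag.) -/
def Clan.orbit {p q : ℕ} (γ : Clan p q) : Set (CompleteFlag (p + q)) :=
  {F | (∀ i : Fin (p + q + 1),
          Module.finrank ℂ ↥(F.space i ⊓ firstSpace p q) = γ.plusRank i) ∧
       (∀ i : Fin (p + q + 1),
          Module.finrank ℂ ↥(F.space i ⊓ lastSpace p q) = γ.minusRank i) ∧
       (∀ i j : Fin (p + q + 1), i < j →
          Module.finrank ℂ ↥((F.space i).map (firstProj p q) ⊔ F.space j) =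
            j + γ.pairRank i j)}

/-! Let `J` be the involution equal to `1` on `E_p` and `-1` on `Ẽ_q`; then `K` is the centralizer
of `J`. A matrix is adapted to a clan if `J` permutes its columns, up to sign, as the clan
prescribes. Two matrices adapted to the same clan differ by left multiplication by an element
commuting with `J`, so the flags adapted to one clan form a single `K`-orbit
(`adaptedFlags_eq_orbit`). An eigenbasis computation shows that they satisfy the rank conditions
defining `Q_γ`. Conversely every flag is adapted to some clan (`exists_mem_adaptedFlags`), and the
ranks determine the clan (`eq_of_rank_eq`), so this orbit is all of `Q_γ`.

The main tool is the projective line of flags that differ from a given one only in the space `F_b`,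
where `b = a + 1` in zero-based positions. At a descent `γ(b) < γ(a)` of the clan, all but one or
two points of the line through an adapted flag stay in `Q_γ`. The exceptional points belong to the
clan with `a`, `b` swapped or, if `a` and `b` are mates, to the two clans with the pair replaced by
opposite signs. Hence such lines lie in the closure of `Q_γ`. Since lines connect all flags, the
same analysis shows that every flag is adapted to a clan.

Closure inclusion implies the rank inequalities by semicontinuity of rank. For the converse, induct
on `τ` by removing a descent, which gives a clan `τ'` with `Y_τ' ⊆ Y_τ` whose ranks differ from
those of `τ` only at index `b`. The combinatorial core is a lifting property
(`RankLE.exists_adjacent`): if `γ ≤ τ`, the line through a flag of `Q_γ` meets some `Q_γ'` with `γ'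
≤ τ'`. Then `Q_γ' ⊆ Y_τ' ⊆ Y_τ`, and since `Y_τ` is a union of lines of this type
(`closure_stable`), it contains `Q_γ`. With no descent left, `τ` consists of signs only and `γ ≤ τ`
forces `γ = τ`. -/

/-! ### Rank functions of clans: counting formulas and recurrences. -/

theorem Finset.card_filter_fin_lt_succ {n : ℕ} (P : Fin n → Prop) [DecidablePred P] (k : Fin n) :
    (Finset.univ.filter fun x : Fin n => (x : ℕ) < k + 1 ∧ P x).card =
      (Finset.univ.filter fun x : Fin n => (x : ℕ) < k ∧ P x).card + if P k then 1 else 0 := by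
  split_ifs with h
  · rw [← Finset.card_insert_of_notMem (a := k) (by simp)]
    congr 1
    ext x
    simp only [Finset.mem_filter, Finset.mem_univ, true_and, Finset.mem_insert]
    constructor
    · rintro ⟨hx, hP⟩
      by_cases hxk : x = k
      · exact .inl hxk
      · exact .inr ⟨by have := Fin.val_ne_of_ne hxk; omega, hP⟩
    · rintro (rfl | ⟨hx, hP⟩)
      · exact ⟨by omega, h⟩
      · exact ⟨by omega, hP⟩
  · rw [add_zero]
    congr 1
    ext x
    simp only [Finset.mem_filter, Finset.mem_univ, true_and]
    refine and_congr_left fun hP => ?_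
    have hxk : x ≠ k := by rintro rfl; exact h hP
    have := Fin.val_ne_of_ne hxk
    omega

namespace Clan

variable {p q : ℕ}

theorem card_pairs_filter (γ : Clan p q) (i : ℕ) :
    (γ.pairs.filter fun x => (x.1 : ℕ) < i ∧ (x.2 : ℕ) < i).card =
      (Finset.univ.filter fun k : Fin (p + q) => (k : ℕ) < i ∧ γ.perm k < k).card := by
  refine Finset.card_bij (fun x _ => x.2) ?_ ?_ ?_
  · rintro ⟨s, t⟩ h
    simp only [pairs, Finset.mem_filter, Finset.mem_univ, true_and] at h ⊢
    refine ⟨h.2.2, ?_⟩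
    rw [← h.1.2, γ.perm_perm, h.1.2]
    exact h.1.1
  · rintro ⟨s, t⟩ h ⟨s', t'⟩ h' e
    simp only [pairs, Finset.mem_filter, Finset.mem_univ, true_and] at h h' e
    have : s = s' := γ.perm.injective (by rw [h.1.2, h'.1.2, e])
    rw [this, e]
  · intro t h
    simp only [Finset.mem_filter, Finset.mem_univ, true_and] at h
    refine ⟨(γ.perm t, t), ?_, rfl⟩
    simp only [pairs, Finset.mem_filter, Finset.mem_univ, true_and, γ.perm_perm, and_true]
    have := Fin.lt_def.1 h.2
    exact ⟨h.2, by omega, h.1⟩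

theorem plusRank_eq (γ : Clan p q) (i : ℕ) :
    γ.plusRank i = (Finset.univ.filter fun k : Fin (p + q) =>
      (k : ℕ) < i ∧ (k ∈ γ.plus ∨ γ.perm k < k)).card := by
  rw [plusRank, card_pairs_filter, ← Finset.card_union_of_disjoint]
  · congr 1
    ext k
    simp only [Finset.mem_union, Finset.mem_filter, Finset.mem_univ, true_and]
    tauto
  · rw [Finset.disjoint_left]
    intro k hk hk'
    simp only [Finset.mem_filter, Finset.mem_univ, true_and] at hk hk'
    exact hk'.2.ne (γ.perm_plus k hk.1)

theorem minusRank_eq (γ : Clan p q) (i : ℕ) :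
    γ.minusRank i = (Finset.univ.filter fun k : Fin (p + q) =>
      (k : ℕ) < i ∧ (k ∈ γ.minus ∨ γ.perm k < k)).card := by
  rw [minusRank, card_pairs_filter, ← Finset.card_union_of_disjoint]
  · congr 1
    ext k
    simp only [Finset.mem_union, Finset.mem_filter, Finset.mem_univ, true_and]
    tauto
  · rw [Finset.disjoint_left]
    intro k hk hk'
    simp only [minus, Finset.mem_filter, Finset.mem_univ, true_and] at hk hk'
    exact hk'.2.ne hk.1.1

theorem pairRank_eq (γ : Clan p q) {i j : ℕ} (hij : i ≤ j) :
    γ.pairRank i j = (Finset.univ.filter fun k : Fin (p + q) =>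
      (k : ℕ) < i ∧ j ≤ (γ.perm k : ℕ)).card := by
  rw [pairRank]
  refine Finset.card_bij (fun x _ => x.1) ?_ ?_ ?_
  · rintro ⟨s, t⟩ h
    simp only [pairs, Finset.mem_filter, Finset.mem_univ, true_and] at h ⊢
    rw [h.1.2]
    exact h.2
  · rintro ⟨s, t⟩ h ⟨s', t'⟩ h' e
    simp only [pairs, Finset.mem_filter, Finset.mem_univ, true_and] at h h' e
    rw [← h.1.2, ← h'.1.2, e]
  · intro s h
    simp only [Finset.mem_filter, Finset.mem_univ, true_and] at h
    refine ⟨(s, γ.perm s), ?_, rfl⟩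
    simp only [pairs, Finset.mem_filter, Finset.mem_univ, true_and, and_true]
    exact ⟨Fin.lt_def.2 (by omega), h⟩

theorem plusRank_succ (γ : Clan p q) (k : Fin (p + q)) :
    γ.plusRank (k + 1) = γ.plusRank k + if k ∈ γ.plus ∨ γ.perm k < k then 1 else 0 := by
  rw [plusRank_eq, plusRank_eq, Finset.card_filter_fin_lt_succ]

theorem minusRank_succ (γ : Clan p q) (k : Fin (p + q)) :
    γ.minusRank (k + 1) = γ.minusRank k + if k ∈ γ.minus ∨ γ.perm k < k then 1 else 0 := by
  rw [minusRank_eq, minusRank_eq, Finset.card_filter_fin_lt_succ]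

theorem pairRank_succ_left (γ : Clan p q) (k : Fin (p + q)) {j : ℕ} (hj : (k : ℕ) + 1 ≤ j) :
    γ.pairRank (k + 1) j = γ.pairRank k j + if j ≤ (γ.perm k : ℕ) then 1 else 0 := by
  rw [pairRank_eq γ hj, pairRank_eq γ (by omega), Finset.card_filter_fin_lt_succ]

theorem pairRank_right (γ : Clan p q) (k : Fin (p + q)) {i : ℕ} (hi : i ≤ k) :
    γ.pairRank i k = γ.pairRank i (k + 1) + if (γ.perm k : ℕ) < i then 1 else 0 := by
  rw [pairRank_eq γ hi, pairRank_eq γ (by omega)]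
  split_ifs with h
  · rw [← Finset.card_insert_of_notMem (a := γ.perm k) (by simp [γ.perm_perm])]
    congr 1
    ext x
    simp only [Finset.mem_filter, Finset.mem_univ, true_and, Finset.mem_insert]
    constructor
    · rintro ⟨hx, hP⟩
      by_cases hxk : γ.perm x = k
      · exact .inl (by rw [← hxk, γ.perm_perm])
      · exact .inr ⟨hx, by have := Fin.val_ne_of_ne hxk; omega⟩
    · rintro (rfl | ⟨hx, hP⟩)
      · rw [γ.perm_perm]
        exact ⟨h, le_rfl⟩
      · exact ⟨hx, by omega⟩
  · rw [add_zero]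
    congr 1
    ext x
    simp only [Finset.mem_filter, Finset.mem_univ, true_and]
    refine and_congr_right fun hx => ?_
    have hxk : γ.perm x ≠ k := by
      rintro rfl
      rw [γ.perm_perm] at h
      exact h hx
    have := Fin.val_ne_of_ne hxk
    omega

theorem mem_minus (γ : Clan p q) {k : Fin (p + q)} :
    k ∈ γ.minus ↔ γ.perm k = k ∧ k ∉ γ.plus := by
  simp [minus]

@[simp] theorem plusRank_zero (γ : Clan p q) : γ.plusRank 0 = 0 := by simp [plusRank]

@[simp] theorem minusRank_zero (γ : Clan p q) : γ.minusRank 0 = 0 := by simp [minusRank]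

@[simp] theorem pairRank_zero (γ : Clan p q) (j : ℕ) : γ.pairRank 0 j = 0 := by simp [pairRank]

/-- Each of the first `m` positions is a sign, a member of a completed pair, or an opener whose mate
comes later; a completed pair has two members and is counted once in each sign rank. The identity
makes the diagonal pair ranks redundant and ties the three families of inequalities together. -/
theorem pairRank_diag (γ : Clan p q) {m : ℕ} (hm : m ≤ p + q) :
    γ.pairRank m m + γ.plusRank m + γ.minusRank m = m := by
  induction m with
  | zero => simp
  | succ m ih =>
    have h := ih (by omega)
    let k : Fin (p + q) := ⟨m, hm⟩
    have h1 := γ.plusRank_succ k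
    have h2 := γ.minusRank_succ k
    have h3 := γ.pairRank_succ_left k le_rfl
    have h4 := γ.pairRank_right k le_rfl
    have hk : (k : ℕ) = m := rfl
    simp only [hk] at h1 h2 h3 h4
    rw [h1, h2, h3]
    have hp := γ.perm_plus k
    simp only [mem_minus]
    rcases lt_trichotomy (γ.perm k) k with hlt | heq | hgt
    · have : k ∉ γ.plus := fun hc => hlt.ne (hp hc)
      have h5 := Fin.lt_def.1 hlt
      rw [if_pos (by omega)] at h4
      rw [if_neg (by omega), if_pos (.inr hlt), if_pos (.inr hlt)]
      omega
    · rw [if_neg (by omega)] at h4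
      rw [if_neg (by rw [heq]; omega)]
      by_cases hkp : k ∈ γ.plus
      · simp [hkp, heq]
        omega
      · simp [hkp, heq]
        omega
    · have : k ∉ γ.plus := fun hc => hgt.ne' (hp hc)
      have h5 := Fin.lt_def.1 hgt
      rw [if_neg (by omega)] at h4
      rw [if_pos (by omega), if_neg (by simp [this, hgt.le]),
        if_neg (by simp [this, hgt.le, hgt.ne'])]
      omega

/-! ### The rank order, and recovery of a clan from its ranks. -/

/-- The order on clans given by the rank conditions. -/
structure RankLE (γ τ : Clan p q) : Prop where
  plus : ∀ i ≤ p + q, τ.plusRank i ≤ γ.plusRank i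
  minus : ∀ i ≤ p + q, τ.minusRank i ≤ γ.minusRank i
  pair : ∀ i j, i ≤ j → j ≤ p + q → γ.pairRank i j ≤ τ.pairRank i j

theorem rankLE_iff (γ τ : Clan p q) : γ.RankLE τ ↔
    (∀ i : ℕ, 1 ≤ i → i ≤ p + q → γ.plusRank i ≥ τ.plusRank i) ∧
    (∀ i : ℕ, 1 ≤ i → i ≤ p + q → γ.minusRank i ≥ τ.minusRank i) ∧
    (∀ i j : ℕ, 1 ≤ i → i < j → j ≤ p + q → γ.pairRank i j ≤ τ.pairRank i j) := by
  constructor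
  · intro h
    exact ⟨fun i _ hi => h.plus i hi, fun i _ hi => h.minus i hi,
      fun i j _ hij hj => h.pair i j hij.le hj⟩
  · rintro ⟨h1, h2, h3⟩
    have h1' : ∀ i ≤ p + q, τ.plusRank i ≤ γ.plusRank i := fun i hi => by
      rcases Nat.eq_zero_or_pos i with rfl | h
      · simp
      · exact h1 i h hi
    have h2' : ∀ i ≤ p + q, τ.minusRank i ≤ γ.minusRank i := fun i hi => by
      rcases Nat.eq_zero_or_pos i with rfl | h
      · simp
      · exact h2 i h hi
    refine ⟨h1', h2', fun i j hij hj => ?_⟩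
    rcases Nat.eq_zero_or_pos i with rfl | h
    · simp
    · rcases hij.eq_or_lt with rfl | hlt
      · have := γ.pairRank_diag hj
        have := τ.pairRank_diag hj
        have := h1' i hj
        have := h2' i hj
        omega
      · exact h3 i j h hlt hj

/-- The jump of `γ(·; j)` at `k` tells whether the mate of `k` is at least `j`; varying `j > k`
locates the mate of an opener. -/
theorem perm_eq_of_lt_of_pairRank_eq {γ δ : Clan p q}
    (h : ∀ i j, i ≤ j → j ≤ p + q → γ.pairRank i j = δ.pairRank i j) {k : Fin (p + q)}
    (hk : k < γ.perm k) : δ.perm k = γ.perm k := by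
  have key : ∀ j, (k : ℕ) + 1 ≤ j → j ≤ p + q → (j ≤ (γ.perm k : ℕ) ↔ j ≤ (δ.perm k : ℕ)) := by
    intro j hj hjn
    have h1 := γ.pairRank_succ_left k hj
    have h2 := δ.pairRank_succ_left k hj
    rw [h _ _ hj hjn, h _ _ (by omega) hjn] at h1
    by_cases c1 : j ≤ (γ.perm k : ℕ) <;> by_cases c2 : j ≤ (δ.perm k : ℕ) <;>
      simp only [c1, c2, if_true, if_false] at h1 h2 ⊢ <;> omega
  have h1 := Fin.lt_def.1 hk
  have h2 := (key _ h1 (by omega)).1 le_rfl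
  have h3 := (key (δ.perm k) (by omega) (by omega)).2 le_rfl
  exact Fin.ext (by omega)

theorem perm_eq_of_pairRank_eq {γ δ : Clan p q}
    (h : ∀ i j, i ≤ j → j ≤ p + q → γ.pairRank i j = δ.pairRank i j) : γ.perm = δ.perm := by
  have aux : ∀ (γ δ : Clan p q),
      (∀ i j, i ≤ j → j ≤ p + q → γ.pairRank i j = δ.pairRank i j) →
      ∀ k, γ.perm k ≠ k → γ.perm k = δ.perm k := by
    intro γ δ h k hk
    rcases lt_or_gt_of_ne hk with hlt | hgt
    · have := perm_eq_of_lt_of_pairRank_eq h (k := γ.perm k) (by rwa [γ.perm_perm])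
      rw [γ.perm_perm] at this
      rw [← δ.perm_perm (γ.perm k), this]
    · exact (perm_eq_of_lt_of_pairRank_eq h hgt).symm
  ext1 k
  by_cases h1 : γ.perm k = k
  · by_cases h2 : δ.perm k = k
    · rw [h1, h2]
    · exact (aux δ γ (fun i j hij hj => (h i j hij hj).symm) k h2).symm
  · exact aux γ δ h k h1

theorem ext_of_perm_plus {γ δ : Clan p q} (h1 : γ.perm = δ.perm) (h2 : γ.plus = δ.plus) :
    γ = δ := by
  cases γ
  cases δ
  simp only at h1 h2
  subst h1 h2
  rfl

/-- The pair ranks give the involution, and the jumps of the plus rank then single out the `+` signs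
among its fixed points. -/
theorem eq_of_rank_eq {γ δ : Clan p q} (hp : ∀ i ≤ p + q, γ.plusRank i = δ.plusRank i)
    (h : ∀ i j, i ≤ j → j ≤ p + q → γ.pairRank i j = δ.pairRank i j) : γ = δ := by
  have hperm := perm_eq_of_pairRank_eq h
  refine ext_of_perm_plus hperm ?_
  ext k
  have h1 := γ.plusRank_succ k
  have h2 := δ.plusRank_succ k
  rw [hp _ (by omega), hp _ (by omega)] at h1
  have hγ := γ.perm_plus k
  have hδ := δ.perm_plus k
  rw [hperm] at h1 hγ
  by_cases hc : δ.perm k < k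
  · exact ⟨fun h => absurd (hγ h) hc.ne, fun h => absurd (hδ h) hc.ne⟩
  · by_cases c1 : k ∈ γ.plus <;> by_cases c2 : k ∈ δ.plus <;>
      simp only [hc, c1, c2, or_false, if_true, if_false] at h1 h2 ⊢ <;> omega

/-- The pair ranks of `τ` vanish, hence so do those of `γ`. By `pairRank_diag` the two sign ranks
then have the same sum for both clans, so the inequalities between them are equalities. -/
theorem RankLE.eq_of_perm_eq_one {γ τ : Clan p q} (h : γ.RankLE τ) (hτ : τ.perm = 1) :
    γ = τ := by
  have hzero : ∀ i j, i ≤ j → τ.pairRank i j = 0 := by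
    intro i j hij
    rw [pairRank_eq τ hij, Finset.card_eq_zero, Finset.filter_eq_empty_iff]
    intro k _
    rw [hτ, Equiv.Perm.one_apply]
    omega
  refine eq_of_rank_eq (fun i hi => ?_) fun i j hij hj => ?_
  · have := γ.pairRank_diag hi
    have := τ.pairRank_diag hi
    have := h.plus i hi
    have := h.minus i hi
    have := h.pair i i le_rfl hi
    have := hzero i i le_rfl
    omega
  · have := h.pair i j hij hj
    have := hzero i j hij
    omega

/-- Two clans have the same ranks except possibly for those involving the index `m`. -/
structure RankEqOff (m : ℕ) (γ δ : Clan p q) : Prop where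
  plus : ∀ i ≤ p + q, i ≠ m → γ.plusRank i = δ.plusRank i
  minus : ∀ i ≤ p + q, i ≠ m → γ.minusRank i = δ.minusRank i
  pair : ∀ i j, i < j → j ≤ p + q → i ≠ m → j ≠ m → γ.pairRank i j = δ.pairRank i j

theorem RankEqOff.pair_le {m : ℕ} {γ δ : Clan p q} (h : γ.RankEqOff m δ) {i j : ℕ} (hij : i ≤ j)
    (hj : j ≤ p + q) (hi : i ≠ m) (hjm : j ≠ m) : γ.pairRank i j = δ.pairRank i j := by
  rcases hij.eq_or_lt with rfl | hlt
  · have := γ.pairRank_diag hj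
    have := δ.pairRank_diag hj
    have := h.plus i hj hi
    have := h.minus i hj hi
    omega
  · exact h.pair i j hlt hj hi hjm

theorem RankEqOff.refl (m : ℕ) (γ : Clan p q) : γ.RankEqOff m γ :=
  ⟨fun _ _ _ => rfl, fun _ _ _ => rfl, fun _ _ _ _ _ _ => rfl⟩

/-! ### The effect of an ascent on the rank inequalities at one index. -/

section Descent

variable {γ γ' τ τ' : Clan p q} {a b : Fin (p + q)}

/-- At an ascent the jumps of `γ'(·; j)` at `a` and `b` are `0,0`, `0,1` or `1,1`, so this rank is
convex around `b`. An upper bound at the neighbours `a` and `b + 1` by a function with jumps `0` or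
`1` therefore propagates to `b`. The same argument applies in the second variable. -/
theorem RankLE.pair_of_ascent (h : γ.RankLE τ) (hab : (b : ℕ) = a + 1)
    (hτ : τ'.RankEqOff b τ) (hγ : γ'.RankEqOff b γ) (hasc : γ'.perm a < γ'.perm b)
    {i j : ℕ} (hij : i < j) (hj : j ≤ p + q) : γ'.pairRank i j ≤ τ'.pairRank i j := by
  have hlt := Fin.lt_def.1 hasc
  have hbn := b.isLt
  by_cases hib : i = b
  · have e1 := γ'.pairRank_succ_left a (j := j) (by omega)
    have e2 := γ'.pairRank_succ_left b (j := j) (by omega)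
    have e3 := τ'.pairRank_succ_left a (j := j) (by omega)
    have e4 := τ'.pairRank_succ_left b (j := j) (by omega)
    have f1 := hγ.pair_le (i := a) (j := j) (by omega) hj (by omega) (by omega)
    have f2 := hγ.pair_le (i := b + 1) (j := j) (by omega) hj (by omega) (by omega)
    have f3 := hτ.pair_le (i := a) (j := j) (by omega) hj (by omega) (by omega)
    have f4 := hτ.pair_le (i := b + 1) (j := j) (by omega) hj (by omega) (by omega)
    have g1 := h.pair a j (by omega) hj
    have g2 := h.pair (b + 1) j (by omega) hj
    rw [← hab] at e1 e3
    subst hib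
    split_ifs at e1 e2 e3 e4 <;> omega
  · by_cases hjb : j = b
    · have e1 := γ'.pairRank_right a (i := i) (by omega)
      have e2 := γ'.pairRank_right b (i := i) (by omega)
      have e3 := τ'.pairRank_right a (i := i) (by omega)
      have e4 := τ'.pairRank_right b (i := i) (by omega)
      have f1 := hγ.pair_le (i := i) (j := a) (by omega) (by omega) (by omega) (by omega)
      have f2 := hγ.pair_le (i := i) (j := b + 1) (by omega) (by omega) (by omega) (by omega)
      have f3 := hτ.pair_le (i := i) (j := a) (by omega) (by omega) (by omega) (by omega)
      have f4 := hτ.pair_le (i := i) (j := b + 1) (by omega) (by omega) (by omega) (by omega)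
      have g1 := h.pair i a (by omega) (by omega)
      have g2 := h.pair i (b + 1) (by omega) (by omega)
      rw [← hab] at e1 e3
      subst hjb
      split_ifs at e1 e2 e3 e4 <;> omega
    · rw [hγ.pair i j hij hj hib hjb, hτ.pair i j hij hj hib hjb]
      exact h.pair i j hij.le hj

/-- The bound at `b` can fail only if `r` and `t` agree at `a`, `t` jumps at `a`, and `r` jumps at
`b` but not at `a`. At an ascent the last condition forces both positions to be fixed, with only `b`
in `S`: two opposite signs. These failure conditions are what `hsign` excludes. It is used for both
signs. -/
theorem signRank_of_ascent {u v : Equiv.Perm (Fin (p + q))} {S T : Finset (Fin (p + q))}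
    {r t : ℕ → ℕ} (hab : (b : ℕ) = a + 1) (hS : ∀ k ∈ S, u k = k) (hasc : u a < u b)
    (ra : r b = r a + if a ∈ S ∨ u a < a then 1 else 0)
    (rb : r (b + 1) = r b + if b ∈ S ∨ u b < b then 1 else 0)
    (ta : t b = t a + if a ∈ T ∨ v a < a then 1 else 0)
    (tb : t (b + 1) = t b + if b ∈ T ∨ v b < b then 1 else 0)
    (ha : t a ≤ r a) (hb : t (b + 1) ≤ r (b + 1))
    (hsign : ¬ (u a = a ∧ a ∉ S ∧ b ∈ S) ∨ ¬ (a ∈ T ∨ v a < a) ∨ r a ≠ t a) : t b ≤ r b := by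
  have hlt := Fin.lt_def.1 hasc
  by_contra hcon
  by_cases c1 : a ∈ S ∨ u a < a
  · rw [if_pos c1] at ra
    split_ifs at ta <;> omega
  rw [if_neg c1] at ra
  by_cases c2 : b ∈ S ∨ u b < b
  · rw [if_pos c2] at rb
    by_cases c3 : a ∈ T ∨ v a < a
    · rw [if_pos c3] at ta
      push Not at c1
      have h1 := Fin.le_def.1 c1.2
      rcases c2 with c2 | c2
      · rw [hS b c2] at hlt
        have hfix : u a = a := Fin.ext (by omega)
        rcases hsign with hs | hs | hs
        · exact hs ⟨hfix, c1.1, c2⟩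
        · exact hs c3
        · omega
      · have h2 := Fin.lt_def.1 c2
        omega
    · rw [if_neg c3] at ta
      omega
  · rw [if_neg c2] at rb
    split_ifs at ta tb <;> omega

theorem RankLE.plus_of_ascent (h : γ.RankLE τ) (hab : (b : ℕ) = a + 1)
    (hτ : τ'.RankEqOff b τ) (hγ : γ'.RankEqOff b γ) (hasc : γ'.perm a < γ'.perm b)
    (hsign : ¬ (a ∈ γ'.minus ∧ b ∈ γ'.plus) ∨ ¬ (a ∈ τ'.plus ∨ τ'.perm a < a) ∨
      γ'.plusRank a ≠ τ'.plusRank a)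
    {i : ℕ} (hi : i ≤ p + q) : τ'.plusRank i ≤ γ'.plusRank i := by
  by_cases hib : i = b
  · have hbn := b.isLt
    have ra := γ'.plusRank_succ a
    have ta := τ'.plusRank_succ a
    rw [← hab] at ra ta
    rw [hib]
    refine signRank_of_ascent hab γ'.perm_plus hasc ra (γ'.plusRank_succ b) ta
      (τ'.plusRank_succ b) ?_ ?_ (hsign.imp_left fun hs hc => hs ⟨γ'.mem_minus.2 ⟨hc.1, hc.2.1⟩,
        hc.2.2⟩)
    · rw [hγ.plus a (by omega) (by omega), hτ.plus a (by omega) (by omega)]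
      exact h.plus a (by omega)
    · rw [hγ.plus _ (by omega) (by omega), hτ.plus _ (by omega) (by omega)]
      exact h.plus _ (by omega)
  · rw [hγ.plus i hi hib, hτ.plus i hi hib]
    exact h.plus i hi

theorem RankLE.minus_of_ascent (h : γ.RankLE τ) (hab : (b : ℕ) = a + 1)
    (hτ : τ'.RankEqOff b τ) (hγ : γ'.RankEqOff b γ) (hasc : γ'.perm a < γ'.perm b)
    (hsign : ¬ (a ∈ γ'.plus ∧ b ∈ γ'.minus) ∨ ¬ (a ∈ τ'.minus ∨ τ'.perm a < a) ∨
      γ'.minusRank a ≠ τ'.minusRank a)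
    {i : ℕ} (hi : i ≤ p + q) : τ'.minusRank i ≤ γ'.minusRank i := by
  by_cases hib : i = b
  · have hbn := b.isLt
    have ra := γ'.minusRank_succ a
    have ta := τ'.minusRank_succ a
    rw [← hab] at ra ta
    rw [hib]
    refine signRank_of_ascent hab (fun k hk => (γ'.mem_minus.1 hk).1) hasc ra
      (γ'.minusRank_succ b) ta (τ'.minusRank_succ b) ?_ ?_ (hsign.imp_left fun hs hc =>
        hs ⟨?_, hc.2.2⟩)
    · rw [hγ.minus a (by omega) (by omega), hτ.minus a (by omega) (by omega)]
      exact h.minus a (by omega)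
    · rw [hγ.minus _ (by omega) (by omega), hτ.minus _ (by omega) (by omega)]
      exact h.minus _ (by omega)
    · by_contra ha
      exact hc.2.1 (γ'.mem_minus.2 ⟨hc.1, ha⟩)
  · rw [hγ.minus i hi hib, hτ.minus i hi hib]
    exact h.minus i hi

/-- Passing to an adjacent clan with an ascent preserves the rank order, unless that clan has two
opposite signs there. -/
theorem RankLE.of_ascent (h : γ.RankLE τ) (hab : (b : ℕ) = a + 1)
    (hτ : τ'.RankEqOff b τ) (hγ : γ'.RankEqOff b γ) (hasc : γ'.perm a < γ'.perm b)
    (h1 : ¬ (a ∈ γ'.minus ∧ b ∈ γ'.plus)) (h2 : ¬ (a ∈ γ'.plus ∧ b ∈ γ'.minus)) :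
    γ'.RankLE τ' := by
  refine ((rankLE_iff _ _).2 ⟨fun i _ hi => ?_, fun i _ hi => ?_, fun i j _ hij hj => ?_⟩)
  · exact h.plus_of_ascent hab hτ hγ hasc (.inl h1) hi
  · exact h.minus_of_ascent hab hτ hγ hasc (.inl h2) hi
  · exact h.pair_of_ascent hab hτ hγ hasc hij hj

/-- Among two adjacent clans carrying the opposite signs `+-` and `-+`, at least one stays below
any adjacent clan of a larger clan. -/
theorem RankLE.of_opposite_signs {γ₁ γ₂ : Clan p q} (h : γ.RankLE τ) (hab : (b : ℕ) = a + 1)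
    (hτ : τ'.RankEqOff b τ) (hγ₁ : γ₁.RankEqOff b γ) (hγ₂ : γ₂.RankEqOff b γ)
    (h₁a : a ∈ γ₁.plus) (h₁b : b ∈ γ₁.minus) (h₂a : a ∈ γ₂.minus) (h₂b : b ∈ γ₂.plus) :
    γ₁.RankLE τ' ∨ γ₂.RankLE τ' := by
  have hbn := b.isLt
  have p1a := γ₁.perm_plus a h₁a
  have p1b := (γ₁.mem_minus.1 h₁b).1
  have p2a := (γ₂.mem_minus.1 h₂a).1
  have p2b := γ₂.perm_plus b h₂b
  have hasc₁ : γ₁.perm a < γ₁.perm b := by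
    rw [p1a, p1b, Fin.lt_def]
    omega
  have hasc₂ : γ₂.perm a < γ₂.perm b := by
    rw [p2a, p2b, Fin.lt_def]
    omega
  by_cases c₁ : ¬ (a ∈ τ'.minus ∨ τ'.perm a < a) ∨ γ₁.minusRank a ≠ τ'.minusRank a
  · left
    refine ((rankLE_iff _ _).2 ⟨fun i _ hi => ?_, fun i _ hi => ?_, fun i j _ hij hj => ?_⟩)
    · exact h.plus_of_ascent hab hτ hγ₁ hasc₁ (.inl fun hc => (γ₁.mem_minus.1 hc.1).2 h₁a) hi
    · exact h.minus_of_ascent hab hτ hγ₁ hasc₁ (.inr c₁) hi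
    · exact h.pair_of_ascent hab hτ hγ₁ hasc₁ hij hj
  by_cases c₂ : ¬ (a ∈ τ'.plus ∨ τ'.perm a < a) ∨ γ₂.plusRank a ≠ τ'.plusRank a
  · right
    refine ((rankLE_iff _ _).2 ⟨fun i _ hi => ?_, fun i _ hi => ?_, fun i j _ hij hj => ?_⟩)
    · exact h.plus_of_ascent hab hτ hγ₂ hasc₂ (.inr c₂) hi
    · exact h.minus_of_ascent hab hτ hγ₂ hasc₂ (.inl fun hc => (γ₂.mem_minus.1 h₂a).2 hc.1) hi
    · exact h.pair_of_ascent hab hτ hγ₂ hasc₂ hij hj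
  -- If both candidates fail, `τ'` closes a pair at `a`, and all ranks at `a`, including the
  -- diagonal pair rank, agree with those of `γ₁`. Passing from `j = a` to `j = b + 1` lowers the
  -- pair rank of `τ'` but not that of `γ₁`, contradicting the inequality at `(a, b + 1)`.
  exfalso
  push Not at c₁ c₂
  have hclose : τ'.perm a < a := by
    rcases c₁.1 with h1 | h1
    · rcases c₂.1 with h2 | h2
      · exact absurd h2 (τ'.mem_minus.1 h1).2
      · exact h2
    · exact h1
  have hclose' := Fin.lt_def.1 hclose
  have e1 := γ₁.pairRank_right a le_rfl
  have e2 := γ₁.pairRank_right b (i := a) (by omega)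
  have e3 := τ'.pairRank_right a le_rfl
  have e4 := τ'.pairRank_right b (i := a) (by omega)
  have e5 := γ₁.pairRank_diag (m := a) (by omega)
  have e6 := τ'.pairRank_diag (m := a) (by omega)
  have f1 := hγ₁.plus a (by omega) (by omega)
  have f2 := hγ₂.plus a (by omega) (by omega)
  have f3 := hγ₁.pair a (b + 1) (by omega) (by omega) (by omega) (by omega)
  have f4 := hτ.pair a (b + 1) (by omega) (by omega) (by omega) (by omega)
  have g := h.pair a (b + 1) (by omega) (by omega)
  rw [p1a] at e1
  rw [p1b] at e2
  rw [if_neg (by omega)] at e1 e2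
  rw [if_pos (by omega)] at e3
  rw [hab] at e2 e4 f3 f4 g
  have := c₁.2
  have := c₂.2
  split_ifs at e4 <;> omega

end Descent

end Clan

/-! ### Flags as column spans of invertible matrices. -/

theorem Matrix.GeneralLinearGroup.linearIndependent_col {n : ℕ} (g : GL (Fin n) ℂ) :
    LinearIndependent ℂ (g : Matrix (Fin n) (Fin n) ℂ).col :=
  Matrix.linearIndependent_cols_iff_isUnit.2 g.isUnit

namespace CompleteFlag

variable {n : ℕ}

/-- The flag spanned by the successive columns of an invertible matrix. -/
noncomputable def ofGL (g : GL (Fin n) ℂ) : CompleteFlag n := g • standard n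

theorem smul_ofGL (g h : GL (Fin n) ℂ) : g • ofGL h = ofGL (g * h) := by
  rw [ofGL, ofGL, mul_smul]

theorem mem_standard {j : Fin (n + 1)} {a : Fin n → ℂ} :
    a ∈ (standard n).space j ↔ ∀ k : Fin n, (j : ℕ) ≤ k → a k = 0 := by
  change a ∈ Submodule.span ℂ ((Pi.basisFun ℂ (Fin n)) '' _) ↔ _
  rw [Module.Basis.mem_span_image]
  constructor
  · intro h k hk
    by_contra hne
    have := h (a := k) (by simpa using hne)
    simp only [Set.mem_ofPred_eq, Fin.lt_def, Fin.val_castSucc] at this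
    omega
  · intro h k hk
    simp only [Set.mem_ofPred_eq, Fin.lt_def, Fin.val_castSucc]
    by_contra hc
    simp only [Finset.mem_coe, Finsupp.mem_support_iff, Pi.basisFun_repr] at hk
    exact hk (h k (by omega))

theorem mem_ofGL {g : GL (Fin n) ℂ} {j : Fin (n + 1)} {x : Fin n → ℂ} :
    x ∈ (ofGL g).space j ↔
      ∃ a : Fin n → ℂ, (∀ k : Fin n, (j : ℕ) ≤ k → a k = 0) ∧
        (g : Matrix (Fin n) (Fin n) ℂ).mulVec a = x := by
  change x ∈ ((standard n).space j).map (Matrix.toLin' (g : Matrix (Fin n) (Fin n) ℂ)) ↔ _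
  simp only [Submodule.mem_map, mem_standard, Matrix.toLin'_apply]

theorem col_mem_ofGL (g : GL (Fin n) ℂ) {k : Fin n} {j : Fin (n + 1)} (h : (k : ℕ) < j) :
    (g : Matrix (Fin n) (Fin n) ℂ).col k ∈ (ofGL g).space j := by
  refine mem_ofGL.2 ⟨Pi.single k 1, fun l hl => ?_, Matrix.mulVec_single_one _ _⟩
  rw [Pi.single_eq_of_ne]
  rintro rfl
  omega

theorem ofGL_space_le {g : GL (Fin n) ℂ} {j : Fin (n + 1)} {W : Submodule ℂ (Fin n → ℂ)}
    (h : ∀ k : Fin n, (k : ℕ) < j → (g : Matrix (Fin n) (Fin n) ℂ).col k ∈ W) :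
    (ofGL g).space j ≤ W := by
  intro x hx
  obtain ⟨a, ha, rfl⟩ := mem_ofGL.1 hx
  rw [Matrix.mulVec_eq_sum]
  refine Submodule.sum_mem _ fun k _ => ?_
  by_cases hk : (k : ℕ) < j
  · rw [op_smul_eq_smul]
    exact W.smul_mem _ (h k hk)
  · rw [ha k (by omega), MulOpposite.op_zero, zero_smul]
    exact W.zero_mem

theorem space_eq_of_le {F F' : CompleteFlag n} {j : Fin (n + 1)} (h : F.space j ≤ F'.space j) :
    F.space j = F'.space j :=
  Submodule.eq_of_le_of_finrank_eq h (by rw [F.finrank_space, F'.finrank_space])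

theorem ofGL_eq_of_col_mem {g : GL (Fin n) ℂ} {F : CompleteFlag n}
    (h : ∀ k : Fin n, (g : Matrix (Fin n) (Fin n) ℂ).col k ∈ F.space k.succ) : ofGL g = F := by
  ext1
  funext j
  refine space_eq_of_le (ofGL_space_le fun k hk => F.mono ?_ (h k))
  rw [Fin.le_def, Fin.val_succ]
  omega

theorem exists_ofGL (F : CompleteFlag n) : ∃ g, F = ofGL g := by
  have hex : ∀ k : Fin n, ∃ v ∈ F.space k.succ, v ∉ F.space k.castSucc := by
    intro k
    by_contra! hc
    have := Submodule.finrank_mono (show F.space k.succ ≤ F.space k.castSucc from hc)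
    rw [F.finrank_space, F.finrank_space, Fin.val_succ, Fin.val_castSucc] at this
    omega
  choose v hv hv' using hex
  have hspan : ∀ (j : ℕ) (hj : j < n + 1),
      F.space ⟨j, hj⟩ ≤ Submodule.span ℂ (v '' {k | (k : ℕ) < j}) := by
    intro j
    induction j with
    | zero =>
      intro hj
      have h := F.finrank_space ⟨0, hj⟩
      rw [Submodule.finrank_eq_zero.1 h]
      exact bot_le
    | succ j ih =>
      intro hj
      have hjn : j < n := by omega
      have hlt : F.space ⟨j, by omega⟩ ⊔ Submodule.span ℂ {v ⟨j, hjn⟩} = F.space ⟨j + 1, hj⟩ := by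
        refine Submodule.eq_of_le_of_finrank_le (sup_le (F.mono ?_) ?_) ?_
        · rw [Fin.le_def]
          exact Nat.le_succ j
        · rw [Submodule.span_le, Set.singleton_subset_iff]
          exact hv ⟨j, hjn⟩
        · rw [F.finrank_space]
          have h1 : F.space ⟨j, by omega⟩ <
              F.space ⟨j, by omega⟩ ⊔ Submodule.span ℂ {v ⟨j, hjn⟩} := by
            refine lt_of_le_of_ne le_sup_left fun h => hv' ⟨j, hjn⟩ ?_
            change v ⟨j, hjn⟩ ∈ F.space ⟨j, by omega⟩
            rw [h]
            exact Submodule.mem_sup_right (Submodule.mem_span_singleton_self _)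
          have h2 := Submodule.finrank_lt_finrank_of_lt h1
          rw [F.finrank_space] at h2
          exact h2
      rw [← hlt]
      refine sup_le ((ih (by omega)).trans (Submodule.span_mono (Set.image_mono ?_))) ?_
      · intro k (hk : (k : ℕ) < j)
        exact Nat.lt_succ_of_lt hk
      · rw [Submodule.span_le, Set.singleton_subset_iff]
        exact Submodule.subset_span ⟨⟨j, hjn⟩, Nat.lt_succ_self j, rfl⟩
  have htop : ⊤ ≤ Submodule.span ℂ (Set.range v) := by
    have h1 : F.space (Fin.last n) = ⊤ :=
      Submodule.eq_top_of_finrank_eq (by rw [F.finrank_space]; simp)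
    rw [← h1]
    exact (hspan n (Nat.lt_succ_self n)).trans (Submodule.span_mono (Set.image_subset_range _ _))
  have hli : LinearIndependent ℂ v :=
    linearIndependent_of_top_le_span_of_card_eq_finrank htop (by simp)
  have hu : IsUnit (Matrix.of fun r k => v k r) :=
    Matrix.linearIndependent_cols_iff_isUnit.1 hli
  obtain ⟨g, hg⟩ := hu
  refine ⟨g, (ofGL_eq_of_col_mem fun k => ?_).symm⟩
  rw [hg]
  exact hv k

end CompleteFlag

/-! ### Operations on two columns of a matrix. -/

namespace Matrix

variable {ι : Type*} [Fintype ι] [DecidableEq ι]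

/-- The matrix whose right multiplication replaces the columns `a`, `b` by their linear
combinations with coefficients the columns of `m`. -/
def colMix (a b : ι) (m : Matrix (Fin 2) (Fin 2) ℂ) : Matrix ι ι ℂ :=
  of fun r k =>
    if k = a then (if r = a then m 0 0 else 0) + (if r = b then m 1 0 else 0)
    else if k = b then (if r = a then m 0 1 else 0) + (if r = b then m 1 1 else 0)
    else if r = k then 1 else 0

theorem mul_colMix_apply (x : Matrix ι ι ℂ) (a b : ι) (m : Matrix (Fin 2) (Fin 2) ℂ) (r k : ι) :
    (x * colMix a b m) r k =
      if k = a then x r a * m 0 0 + x r b * m 1 0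
      else if k = b then x r a * m 0 1 + x r b * m 1 1
      else x r k := by
  rw [mul_apply]
  simp only [colMix, of_apply]
  split_ifs <;> simp [mul_add, Finset.sum_add_distrib]

theorem colMix_mul {a b : ι} (hab : a ≠ b) (m m' : Matrix (Fin 2) (Fin 2) ℂ) :
    colMix a b (m * m') = colMix a b m * colMix a b m' := by
  ext r k
  rw [mul_colMix_apply]
  simp only [colMix, of_apply, mul_apply, Fin.sum_univ_two, if_neg hab.symm, if_true]
  split_ifs <;> simp_all

/-- `colMix` as a homomorphism of general linear groups. -/
noncomputable def colGL {a b : ι} (hab : a ≠ b) : GL (Fin 2) ℂ →* GL ι ℂ :=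
  Units.map
    { toFun := colMix a b
      map_one' := by
        ext r k
        simp only [colMix, of_apply, one_apply]
        split_ifs <;> simp_all
      map_mul' := colMix_mul hab }

theorem mul_colGL_apply (g : GL ι ℂ) {a b : ι} (hab : a ≠ b) (m : GL (Fin 2) ℂ) (r k : ι) :
    (g * colGL hab m) r k =
      if k = a then g r a * m 0 0 + g r b * m 1 0
      else if k = b then g r a * m 0 1 + g r b * m 1 1
      else g r k :=
  mul_colMix_apply _ _ _ _ _ _

theorem exists_permuted_columns (σ : Equiv.Perm ι) (g : GL ι ℂ) :
    ∃ g' : GL ι ℂ, ∀ r k, g' r k = g r (σ k) := by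
  refine ⟨g * GeneralLinearGroup.mkOfDetNeZero (σ⁻¹.permMatrix ℂ) (by
    rw [det_permutation]
    simp), fun r k => ?_⟩
  change ((g : Matrix ι ι ℂ) * σ⁻¹.permMatrix ℂ) r k = _
  rw [Equiv.Perm.permMatrix, PEquiv.mul_toMatrix_toPEquiv]
  simp [submatrix, Equiv.Perm.inv_def]

/-- An invertible `2 × 2` matrix given by its entries. -/
noncomputable def gl2 (x y z w : ℂ) (h : x * w - y * z ≠ 0) : GL (Fin 2) ℂ :=
  GeneralLinearGroup.mkOfDetNeZero !![x, y; z, w] (by rwa [det_fin_two_of])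

section

variable {x y z w : ℂ} (h : x * w - y * z ≠ 0)

@[simp] theorem gl2_zero_zero : gl2 x y z w h 0 0 = x := rfl

@[simp] theorem gl2_zero_one : gl2 x y z w h 0 1 = y := rfl

@[simp] theorem gl2_one_zero : gl2 x y z w h 1 0 = z := rfl

@[simp] theorem gl2_one_one : gl2 x y z w h 1 1 = w := rfl

end

end Matrix

/-! ### Lines of flags that differ in a single space. -/

namespace CompleteFlag

open Matrix

variable {n : ℕ} {a b : Fin n}

theorem ofGL_mul_colGL_space (g : GL (Fin n) ℂ) (hab : a ≠ b) (hb : (b : ℕ) = a + 1)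
    (m : GL (Fin 2) ℂ) {j : Fin (n + 1)} (hj : (j : ℕ) ≠ b) :
    (ofGL (g * colGL hab m)).space j = (ofGL g).space j := by
  refine space_eq_of_le (ofGL_space_le fun k hk => ?_)
  have hcol : (↑(g * colGL hab m) : Matrix (Fin n) (Fin n) ℂ).col k =
      if k = a then m 0 0 • (g : Matrix (Fin n) (Fin n) ℂ).col a +
        m 1 0 • (g : Matrix (Fin n) (Fin n) ℂ).col b
      else if k = b then m 0 1 • (g : Matrix (Fin n) (Fin n) ℂ).col a +
        m 1 1 • (g : Matrix (Fin n) (Fin n) ℂ).col b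
      else (g : Matrix (Fin n) (Fin n) ℂ).col k := by
    ext r
    refine (mul_colGL_apply g hab m r k).trans ?_
    split_ifs <;> simp [Matrix.col, mul_comm]
  rw [hcol]
  split_ifs with h1 h2
  · subst h1
    exact add_mem (Submodule.smul_mem _ _ (col_mem_ofGL g hk))
      (Submodule.smul_mem _ _ (col_mem_ofGL g (by omega)))
  · subst h2
    exact add_mem (Submodule.smul_mem _ _ (col_mem_ofGL g (by omega)))
      (Submodule.smul_mem _ _ (col_mem_ofGL g hk))
  · exact col_mem_ofGL g hk

/-- `F_b` is spanned by `F_a` and one further vector, so only the first column of `m` matters. -/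
theorem eq_ofGL_mul_colGL {g : GL (Fin n) ℂ} (hab : a ≠ b) (hb : (b : ℕ) = a + 1)
    {m : GL (Fin 2) ℂ} {F : CompleteFlag n}
    (hF : ∀ j : Fin (n + 1), (j : ℕ) ≠ b → F.space j = (ofGL g).space j)
    (hmem : m 0 0 • (g : Matrix (Fin n) (Fin n) ℂ).col a +
      m 1 0 • (g : Matrix (Fin n) (Fin n) ℂ).col b ∈ F.space b.castSucc) :
    F = ofGL (g * colGL hab m) := by
  ext1
  funext j
  by_cases hj : (j : ℕ) = b
  · have hj' : j = b.castSucc := Fin.ext (by simpa using hj)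
    subst hj'
    refine (space_eq_of_le (ofGL_space_le fun k hk => ?_)).symm
    rw [Fin.val_castSucc] at hk
    by_cases hka : k = a
    · subst hka
      convert hmem using 1
      ext r
      refine (mul_colGL_apply g hab m r k).trans ?_
      simp [Matrix.col, mul_comm]
    · have hkb : k ≠ b := by
        rintro rfl
        exact hk.false
      have hka' := Fin.val_ne_of_ne hka
      have hcol : (↑(g * colGL hab m) : Matrix (Fin n) (Fin n) ℂ).col k =
          (g : Matrix (Fin n) (Fin n) ℂ).col k := by
        ext r
        refine (mul_colGL_apply g hab m r k).trans ?_
        rw [if_neg hka, if_neg hkb]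
        rfl
      rw [hcol]
      refine F.mono (a := a.castSucc) ?_ ?_
      · rw [Fin.le_def, Fin.val_castSucc, Fin.val_castSucc]
        omega
      · rw [hF _ (by rw [Fin.val_castSucc]; omega)]
        exact col_mem_ofGL g (by rw [Fin.val_castSucc]; omega)
  · rw [hF j hj, ofGL_mul_colGL_space g hab hb m hj]

theorem exists_eq_ofGL_mul_colGL {g : GL (Fin n) ℂ} (hab : a ≠ b) (hb : (b : ℕ) = a + 1)
    {F : CompleteFlag n} (hF : ∀ j : Fin (n + 1), (j : ℕ) ≠ b → F.space j = (ofGL g).space j) :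
    ∃ m, F = ofGL (g * colGL hab m) := by
  obtain ⟨g', rfl⟩ := exists_ofGL F
  have hw : (g' : Matrix (Fin n) (Fin n) ℂ).col a ∈ (ofGL g').space b.castSucc :=
    col_mem_ofGL g' (by rw [Fin.val_castSucc]; omega)
  have hw1 : (g' : Matrix (Fin n) (Fin n) ℂ).col a ∈ (ofGL g).space b.succ := by
    rw [← hF _ (by simp)]
    exact col_mem_ofGL g' (by rw [Fin.val_succ]; omega)
  have hw2 : (g' : Matrix (Fin n) (Fin n) ℂ).col a ∉ (ofGL g).space a.castSucc := by
    rw [← hF _ (by rw [Fin.val_castSucc]; omega)]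
    intro hc
    obtain ⟨c, hc, hc'⟩ := mem_ofGL.1 hc
    have h1 := hc a (by rw [Fin.val_castSucc])
    rw [← Matrix.mulVec_single_one] at hc'
    have h2 := Matrix.mulVec_injective_of_isUnit g'.isUnit hc'
    rw [h2, Pi.single_eq_same] at h1
    exact one_ne_zero h1
  obtain ⟨c, hc, hc'⟩ := mem_ofGL.1 hw1
  rw [Fin.val_succ] at hc
  -- Modulo `F_a`, a vector of `F_{b+1}` is a combination of the columns `a` and `b`; its two
  -- coefficients will be the first column of `m`.
  have hlow : (g' : Matrix (Fin n) (Fin n) ℂ).col a -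
      (c a • (g : Matrix (Fin n) (Fin n) ℂ).col a + c b • (g : Matrix (Fin n) (Fin n) ℂ).col b) ∈
      (ofGL g).space a.castSucc := by
    refine mem_ofGL.2 ⟨c - (c a • Pi.single a 1 + c b • Pi.single b 1), fun k hk => ?_, ?_⟩
    · rw [Fin.val_castSucc] at hk
      by_cases hka : k = a
      · subst hka
        simp [hab]
      · by_cases hkb : k = b
        · subst hkb
          simp [hab.symm]
        · have := Fin.val_ne_of_ne hka
          have := Fin.val_ne_of_ne hkb
          simp [hka, hkb, hc k (by omega)]
    · rw [Matrix.mulVec_sub, Matrix.mulVec_add, Matrix.mulVec_smul, Matrix.mulVec_smul,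
        Matrix.mulVec_single_one, Matrix.mulVec_single_one, hc']
  have hmem : c a • (g : Matrix (Fin n) (Fin n) ℂ).col a +
      c b • (g : Matrix (Fin n) (Fin n) ℂ).col b ∈ (ofGL g').space b.castSucc := by
    rw [← hF a.castSucc (by rw [Fin.val_castSucc]; omega)] at hlow
    have hle : (ofGL g').space a.castSucc ≤ (ofGL g').space b.castSucc := (ofGL g').mono (by
      rw [Fin.le_def, Fin.val_castSucc, Fin.val_castSucc]
      omega)
    have := sub_mem hw (hle hlow)
    rwa [sub_sub_cancel] at this
  -- The coefficients are not both zero, since the vector is outside `F_a`; complete them to an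
  -- invertible matrix.
  by_cases ha : c a = 0
  · have hcb : c b ≠ 0 := by
      intro hcb
      refine hw2 ?_
      rwa [ha, hcb, zero_smul, zero_smul, add_zero, sub_zero] at hlow
    exact ⟨gl2 (c a) 1 (c b) 0 (by simpa using hcb), eq_ofGL_mul_colGL hab hb hF hmem⟩
  · exact ⟨gl2 (c a) 0 (c b) 1 (by simpa using ha), eq_ofGL_mul_colGL hab hb hF hmem⟩

/-- Adjacent transpositions generate the symmetric group, and each one is a `colGL` move. -/
theorem ofGL_mul_permMatrix_mem {S : Set (CompleteFlag n)}
    (hS : ∀ g (a b : Fin n) (hab : a ≠ b), (b : ℕ) = a + 1 → ofGL g ∈ S →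
      ∀ m, ofGL (g * colGL hab m) ∈ S) (σ : Equiv.Perm (Fin n)) :
    ∀ g g' : GL (Fin n) ℂ, (∀ r k, g' r k = g r (σ k)) → ofGL g ∈ S → ofGL g' ∈ S := by
  cases n with
  | zero =>
    intro g g' _ hg
    rwa [show g' = g from Subsingleton.elim _ _]
  | succ n =>
    have hσ : σ ∈ Submonoid.closure
        (Set.range fun i : Fin n => Equiv.swap i.castSucc i.succ) := by
      rw [Equiv.Perm.mclosure_swap_castSucc_succ]
      trivial
    induction hσ using Submonoid.closure_induction with
    | mem σ hσ =>
      obtain ⟨i, rfl⟩ := hσ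
      intro g g' h hg
      have hab : i.castSucc ≠ i.succ := Fin.castSucc_lt_succ.ne
      convert hS g i.castSucc i.succ hab (by simp) hg (gl2 0 1 1 0 (by norm_num)) using 2
      ext r k
      rw [mul_colGL_apply, h]
      by_cases hk1 : k = i.castSucc
      · subst hk1
        simp
      · by_cases hk2 : k = i.succ
        · subst hk2
          simp [hab.symm]
        · rw [if_neg hk1, if_neg hk2, Equiv.swap_apply_of_ne_of_ne hk1 hk2]
    | one =>
      intro g g' h hg
      rwa [show g' = g from Units.ext (by ext r k; exact h r k)]
    | mul σ τ _ _ hσ hτ =>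
      intro g g' h hg
      obtain ⟨x, hx⟩ := exists_permuted_columns σ g
      refine hτ x g' (fun r k => ?_) (hσ g x hx hg)
      rw [h, hx]
      rfl

/-- A nonempty set of flags that is stable under changing a single space contains all flags. -/
theorem mem_of_stable {S : Set (CompleteFlag n)}
    (hS : ∀ g (a b : Fin n) (hab : a ≠ b), (b : ℕ) = a + 1 → ofGL g ∈ S →
      ∀ m, ofGL (g * colGL hab m) ∈ S) (hne : ofGL 1 ∈ S) (F : CompleteFlag n) : F ∈ S := by
  have key : ∀ M : Matrix (Fin n) (Fin n) ℂ, M.det ≠ 0 → ∀ g g' : GL (Fin n) ℂ,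
      (g' : Matrix (Fin n) (Fin n) ℂ) = g * M → ofGL g ∈ S → ofGL g' ∈ S := by
    intro M hM
    -- Right multiplication by an upper triangular matrix leaves the flag unchanged.
    have upper : ∀ (M : Matrix (Fin n) (Fin n) ℂ), (∀ r k, k < r → M r k = 0) →
        ∀ g g' : GL (Fin n) ℂ, (g' : Matrix (Fin n) (Fin n) ℂ) = g * M →
          ofGL g ∈ S → ofGL g' ∈ S := by
      intro M hM g g' h hg
      rwa [show ofGL g' = ofGL g from ofGL_eq_of_col_mem fun k => by
        refine mem_ofGL.2 ⟨M.col k, fun r hr => hM r k ?_, ?_⟩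
        · rw [Fin.val_succ] at hr
          exact Fin.lt_def.2 (by omega)
        · rw [h]
          rfl]
    refine Matrix.diagonal_transvection_induction_of_det_ne_zero (fun M => ∀ g g' : GL (Fin n) ℂ,
      (g' : Matrix (Fin n) (Fin n) ℂ) = (g : Matrix (Fin n) (Fin n) ℂ) * M →
        ofGL g ∈ S → ofGL g' ∈ S) M hM ?_ ?_ ?_
    · intro D _
      exact upper _ fun r k hrk => Matrix.diagonal_apply_ne _ hrk.ne'
    · rintro ⟨i, j, hij, c⟩
      simp only [TransvectionStruct.toMatrix]
      rcases lt_or_gt_of_ne hij with hlt | hgt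
      · refine upper _ fun r k hrk => ?_
        rw [transvection, Matrix.add_apply, one_apply_ne hrk.ne', zero_add,
          single_apply_of_ne]
        rintro ⟨rfl, rfl⟩
        exact lt_asymm hlt hrk
      -- A lower transvection is an upper one conjugated by the transposition of `i` and `j`.
      · intro g g' h hg
        obtain ⟨x, hx⟩ := exists_permuted_columns (Equiv.swap i j) g
        obtain ⟨y, hy⟩ := exists_permuted_columns (Equiv.swap i j) g'
        refine ofGL_mul_permMatrix_mem hS (Equiv.swap i j) y g' (fun r k => ?_)
          (upper (transvection j i c) (fun r k hrk => ?_) x y ?_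
            (ofGL_mul_permMatrix_mem hS (Equiv.swap i j) g x hx hg))
        · rw [hy, Equiv.swap_apply_self]
        · rw [transvection, Matrix.add_apply, one_apply_ne hrk.ne', zero_add, single_apply_of_ne]
          rintro ⟨rfl, rfl⟩
          exact lt_asymm hgt hrk
        · ext r k
          rw [hy, h, transvection, transvection, mul_add, mul_add, mul_one, mul_one, Matrix.add_apply,
            Matrix.add_apply, hx]
          congr 1
          by_cases hk : k = i
          · subst hk
            rw [Equiv.swap_apply_left, mul_single_apply_same, mul_single_apply_same, hx,
              Equiv.swap_apply_right]
          · rw [mul_single_apply_of_ne _ _ _ _ _ hk, mul_single_apply_of_ne]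
            intro hc
            exact hk (by rw [← Equiv.swap_apply_self i j k, hc, Equiv.swap_apply_right])
    · intro A B hA hB ihA ihB g g' h hg
      refine ihB (g * GeneralLinearGroup.mkOfDetNeZero A hA) g' ?_
        (ihA g (g * GeneralLinearGroup.mkOfDetNeZero A hA) rfl hg)
      rw [h, ← mul_assoc]
      rfl
  obtain ⟨g, rfl⟩ := exists_ofGL F
  exact key g (by
    have := g.isUnit
    rwa [Matrix.isUnit_iff_isUnit_det, isUnit_iff_ne_zero] at this) 1 g (by simp) hne

end CompleteFlag

/-! ### Moves on clans and induction on descents. -/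

theorem Fin.swap_lt_swap {n : ℕ} {a b x y : Fin n} (hb : (b : ℕ) = a + 1) (hxy : x < y)
    (h : ¬ (x = a ∧ y = b)) : Equiv.swap a b x < Equiv.swap a b y := by
  simp only [Equiv.swap_apply_def, Fin.ext_iff, Fin.lt_def] at *
  split_ifs <;> omega

namespace Clan

variable {p q : ℕ}

/-- The contribution of a position to the signature. -/
def charge (u : Equiv.Perm (Fin (p + q))) (S : Finset (Fin (p + q))) (k : Fin (p + q)) : ℤ :=
  if k ∈ S then 1 else if u k = k then -1 else 0

theorem sum_charge (u : Equiv.Perm (Fin (p + q))) (S : Finset (Fin (p + q))) :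
    ∑ k, charge u S k =
      (S.card : ℤ) - ((Finset.univ.filter fun k => u k = k ∧ k ∉ S).card : ℤ) := by
  have h : ∀ k, charge u S k = (if k ∈ S then 1 else 0) - if u k = k ∧ k ∉ S then 1 else 0 := by
    intro k
    simp only [charge]
    split_ifs <;> simp_all
  simp only [h, Finset.sum_sub_distrib, Finset.sum_boole]
  simp

/-- The clan with its positions permuted by `σ`. -/
def conj (γ : Clan p q) (σ : Equiv.Perm (Fin (p + q))) : Clan p q where
  perm := σ⁻¹ * γ.perm * σ
  perm_perm k := by simp [γ.perm_perm]
  plus := Finset.univ.filter fun k => σ k ∈ γ.plus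
  perm_plus k hk := by
    rw [Finset.mem_filter] at hk
    simp [γ.perm_plus _ hk.2]
  signature := by
    rw [← sum_charge, ← γ.signature, ← sum_charge, ← Equiv.sum_comp σ (charge γ.perm γ.plus)]
    refine Finset.sum_congr rfl fun k _ => ?_
    have : σ⁻¹ (γ.perm (σ k)) = k ↔ γ.perm (σ k) = σ k := by
      rw [Equiv.Perm.inv_eq_iff_eq]
    exact if_congr (by simp) rfl (if_congr this rfl rfl)

theorem conj_perm_apply (γ : Clan p q) (σ : Equiv.Perm (Fin (p + q))) (k : Fin (p + q)) :
    (γ.conj σ).perm k = σ⁻¹ (γ.perm (σ k)) := rfl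

theorem mem_conj_plus (γ : Clan p q) (σ : Equiv.Perm (Fin (p + q))) (k : Fin (p + q)) :
    k ∈ (γ.conj σ).plus ↔ σ k ∈ γ.plus := by
  simp [conj]

theorem mem_conj_minus (γ : Clan p q) (σ : Equiv.Perm (Fin (p + q))) (k : Fin (p + q)) :
    k ∈ (γ.conj σ).minus ↔ σ k ∈ γ.minus := by
  rw [mem_minus, mem_minus, mem_conj_plus, conj_perm_apply, Equiv.Perm.inv_eq_iff_eq]

theorem conj_swap_conj_swap (γ : Clan p q) (a b : Fin (p + q)) :
    (γ.conj (Equiv.swap a b)).conj (Equiv.swap a b) = γ := by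
  refine ext_of_perm_plus ?_ ?_
  · ext1 k
    simp [conj_perm_apply]
  · ext k
    simp [mem_conj_plus]

/-- The clan in which the pair through `a` is replaced by a `+` at `a` and a `-` at its mate. -/
def split (γ : Clan p q) (a : Fin (p + q)) (ha : γ.perm a ≠ a) : Clan p q where
  perm := γ.perm * Equiv.swap a (γ.perm a)
  perm_perm k := by
    by_cases h1 : k = a
    · simp [h1, γ.perm_perm]
    by_cases h2 : k = γ.perm a
    · simp [h2]
    have h3 : γ.perm k ≠ a := fun h => h2 (by rw [← h, γ.perm_perm])
    have h4 : γ.perm k ≠ γ.perm a := fun h => h1 (γ.perm.injective h)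
    simp [Equiv.swap_apply_of_ne_of_ne, h1, h2, h3, h4, γ.perm_perm]
  plus := insert a γ.plus
  perm_plus k hk := by
    rcases Finset.mem_insert.1 hk with h | hk'
    · simp [h, γ.perm_perm]
    · have h1 : k ≠ a := fun h => ha (by rw [← h]; exact γ.perm_plus k hk')
      have h2 : k ≠ γ.perm a := by
        rintro rfl
        have := γ.perm_plus _ hk'
        rw [γ.perm_perm] at this
        exact ha this.symm
      simp [Equiv.swap_apply_of_ne_of_ne h1 h2, γ.perm_plus k hk']
  signature := by
    rw [← γ.signature, ← sum_charge, ← sum_charge, ← sub_eq_zero, ← Finset.sum_sub_distrib]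
    -- Only the two ends of the pair change charge, from `0, 0` to `1, -1`.
    rw [Finset.sum_eq_add a (γ.perm a) ha.symm]
    · have h1 : a ∉ γ.plus := fun h => ha (γ.perm_plus a h)
      have h2 : γ.perm a ∉ γ.plus := fun h => ha (by
        have := γ.perm_plus _ h
        rw [γ.perm_perm] at this
        exact this.symm)
      simp [charge, h1, h2, ha, ha.symm, γ.perm_perm]
    · rintro k - ⟨h1, h2⟩
      simp [charge, h1, Equiv.swap_apply_of_ne_of_ne h1 h2]
    · simp
    · simp

section Split

variable (γ : Clan p q) {a : Fin (p + q)} (ha : γ.perm a ≠ a)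

theorem split_perm_left : (γ.split a ha).perm a = a := by
  simp [split, γ.perm_perm]

theorem split_perm_right : (γ.split a ha).perm (γ.perm a) = γ.perm a := by
  simp [split]

theorem split_perm_of_ne {k : Fin (p + q)} (h1 : k ≠ a) (h2 : k ≠ γ.perm a) :
    (γ.split a ha).perm k = γ.perm k := by
  simp [split, Equiv.swap_apply_of_ne_of_ne h1 h2]

theorem mem_split_plus_left : a ∈ (γ.split a ha).plus := by
  simp [split]

theorem mem_split_minus_right : γ.perm a ∈ (γ.split a ha).minus := by
  rw [mem_minus]
  refine ⟨split_perm_right γ ha, ?_⟩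
  simp only [split, Finset.mem_insert, not_or]
  refine ⟨ha, fun h => ha ?_⟩
  have := γ.perm_plus _ h
  rw [γ.perm_perm] at this
  exact this.symm

theorem mem_split_minus_of_ne {k : Fin (p + q)} (h1 : k ≠ a) (h2 : k ≠ γ.perm a) :
    k ∈ (γ.split a ha).minus ↔ k ∈ γ.minus := by
  rw [mem_minus, mem_minus, split_perm_of_ne γ ha h1 h2]
  simp [split, h1]

end Split

/-- The clan in which a `+` at `a` and a `-` at `b` are replaced by a pair. -/
def join (γ : Clan p q) (a b : Fin (p + q)) (ha : a ∈ γ.plus) (hb : b ∈ γ.minus) : Clan p q where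
  perm := γ.perm * Equiv.swap a b
  perm_perm k := by
    have h1 := γ.perm_plus a ha
    have h2 := (γ.mem_minus.1 hb).1
    by_cases h3 : k = a
    · simp [h3, h1, h2]
    by_cases h4 : k = b
    · simp [h4, h1, h2]
    have h5 : γ.perm k ≠ a := fun h => h3 (γ.perm.injective (by rw [h, h1]))
    have h6 : γ.perm k ≠ b := fun h => h4 (γ.perm.injective (by rw [h, h2]))
    simp [Equiv.swap_apply_of_ne_of_ne, h3, h4, h5, h6, γ.perm_perm]
  plus := γ.plus.erase a
  perm_plus k hk := by
    rw [Finset.mem_erase] at hk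
    have h1 : k ≠ b := by
      rintro rfl
      exact (γ.mem_minus.1 hb).2 hk.2
    simp [Equiv.swap_apply_of_ne_of_ne hk.1 h1, γ.perm_plus k hk.2]
  signature := by
    have hb' := γ.mem_minus.1 hb
    have hab : a ≠ b := by
      rintro rfl
      exact hb'.2 ha
    rw [← γ.signature, ← sum_charge, ← sum_charge, ← sub_eq_zero, ← Finset.sum_sub_distrib]
    rw [Finset.sum_eq_add a b hab]
    · simp [charge, ha, hb'.1, hb'.2, hab, hab.symm, γ.perm_plus a ha]
    · rintro k - ⟨h1, h2⟩
      simp [charge, h1, Equiv.swap_apply_of_ne_of_ne h1 h2]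
    · simp
    · simp

section Join

variable (γ : Clan p q) {a b : Fin (p + q)} (ha : a ∈ γ.plus) (hb : b ∈ γ.minus)

theorem join_perm_left : (γ.join a b ha hb).perm a = b := by
  simp [join, (γ.mem_minus.1 hb).1]

theorem join_perm_right : (γ.join a b ha hb).perm b = a := by
  simp [join, γ.perm_plus a ha]

theorem join_perm_of_ne {k : Fin (p + q)} (h1 : k ≠ a) (h2 : k ≠ b) :
    (γ.join a b ha hb).perm k = γ.perm k := by
  simp [join, Equiv.swap_apply_of_ne_of_ne h1 h2]

theorem mem_join_minus_of_ne {k : Fin (p + q)} (h1 : k ≠ a) (h2 : k ≠ b) :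
    k ∈ (γ.join a b ha hb).minus ↔ k ∈ γ.minus := by
  rw [mem_minus, mem_minus, join_perm_of_ne γ ha hb h1 h2]
  simp [join, h1]

end Join

theorem join_split (γ : Clan p q) {a : Fin (p + q)} (ha : γ.perm a ≠ a) :
    (γ.split a ha).join a (γ.perm a) (mem_split_plus_left γ ha) (mem_split_minus_right γ ha) =
      γ := by
  refine ext_of_perm_plus ?_ ?_
  · simp [join, split, mul_assoc]
  · have h1 : a ∉ γ.plus := fun h => ha (γ.perm_plus a h)
    simp [join, split, h1]

/-- The sum of the squared displacements of a clan. -/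
def displacement (γ : Clan p q) : ℤ := ∑ k : Fin (p + q), ((k : ℤ) - (γ.perm k : ℕ)) ^ 2

theorem displacement_nonneg (γ : Clan p q) : 0 ≤ γ.displacement :=
  Finset.sum_nonneg fun _ _ => sq_nonneg _

theorem displacement_split_lt (γ : Clan p q) {a : Fin (p + q)} (ha : γ.perm a ≠ a) :
    (γ.split a ha).displacement < γ.displacement := by
  refine Finset.sum_lt_sum (fun k _ => ?_) ⟨a, Finset.mem_univ _, ?_⟩
  · by_cases h1 : k = a
    · rw [h1, split_perm_left]
      simp only [sub_self]
      positivity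
    by_cases h2 : k = γ.perm a
    · rw [h2, split_perm_right]
      simp only [sub_self]
      positivity
    rw [split_perm_of_ne γ ha h1 h2]
  · rw [split_perm_left, sub_self]
    have := Fin.val_ne_of_ne ha
    have : (a : ℤ) - (γ.perm a : ℕ) ≠ 0 := by omega
    positivity

/-- With `e k = k - γ(k)` and `d` equal to `1` at `a`, `-1` at `b` and `0` elsewhere, expanding the
square changes the sum by `4(e a - e b) + 4 - 2(d(γ a) - d(γ b))`. The descent gives `e a - e b ≤
-2`; as `γ(a) ≠ b`, the last term is at most `2`, so the total is negative. -/
theorem displacement_conj_swap_lt (γ : Clan p q) {a b : Fin (p + q)} (hb : (b : ℕ) = a + 1)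
    (hdesc : γ.perm b < γ.perm a) (hne : γ.perm a ≠ b) :
    (γ.conj (Equiv.swap a b)).displacement < γ.displacement := by
  have hab : a ≠ b := by
    rintro rfl
    omega
  let d : Fin (p + q) → ℤ := fun k => (if k = a then 1 else 0) - (if k = b then 1 else 0)
  let e : Fin (p + q) → ℤ := fun k => (k : ℤ) - (γ.perm k : ℕ)
  have hs : ∀ k, ((Equiv.swap a b k : Fin (p + q)) : ℤ) = (k : ℤ) + d k := by
    intro k
    simp only [d, Equiv.swap_apply_def]
    split_ifs <;> simp_all
  have hd : ∀ x : Fin (p + q) → ℤ, ∑ k, x k * d k = x a - x b := by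
    intro x
    simp [d, mul_sub, Finset.sum_sub_distrib]
  have he : ∀ k, e (γ.perm k) = - e k := by
    intro k
    simp [e, γ.perm_perm]
  have h1 : (γ.conj (Equiv.swap a b)).displacement = ∑ k, (e k + d k - d (γ.perm k)) ^ 2 := by
    rw [displacement, ← Equiv.sum_comp (Equiv.swap a b)]
    refine Finset.sum_congr rfl fun k _ => ?_
    rw [conj_perm_apply, Equiv.swap_apply_self, Equiv.swap_inv, hs, hs]
    simp only [e]
    ring
  have h2 : ∑ k, e k * d (γ.perm k) = -(e a - e b) := by
    rw [← Equiv.sum_comp γ.perm]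
    simp only [γ.perm_perm, he, neg_mul, Finset.sum_neg_distrib, hd]
  have h3 : ∑ k, d (γ.perm k) * d (γ.perm k) = ∑ k, d k * d k :=
    Equiv.sum_comp γ.perm fun k => d k * d k
  have h4 : ∀ k, (e k + d k - d (γ.perm k)) ^ 2 =
      e k ^ 2 + 2 * (e k * d k) - 2 * (e k * d (γ.perm k)) + d k * d k +
        d (γ.perm k) * d (γ.perm k) - 2 * (d (γ.perm k) * d k) := by
    intro k
    ring
  rw [h1]
  simp only [h4, Finset.sum_sub_distrib, Finset.sum_add_distrib, ← Finset.mul_sum, h2, h3, hd]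
  have h5 : γ.displacement = ∑ k, e k ^ 2 := rfl
  rw [← h5]
  have hlt := Fin.lt_def.1 hdesc
  have hda : d a = 1 := by simp [d, hab]
  have hdb : d b = -1 := by simp [d, hab.symm]
  have h6 : 0 ≤ d (γ.perm a) := by
    simp only [d, if_neg hne]
    split_ifs <;> simp
  have h7 : d (γ.perm b) ≤ 1 := by
    simp only [d]
    split_ifs <;> simp
  have h8 : e a - e b = -1 - ((γ.perm a : ℕ) - (γ.perm b : ℕ) : ℤ) := by
    simp only [e]
    push_cast [hb]
    ring
  rw [h8, hda, hdb]
  omega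

theorem perm_eq_one_of_no_descent (γ : Clan p q)
    (h : ∀ a b : Fin (p + q), (b : ℕ) = a + 1 → ¬ γ.perm b < γ.perm a) : γ.perm = 1 := by
  have key : ∀ (l : ℕ) (hl : l < p + q) (k : Fin (p + q)), (k : ℕ) < l →
      γ.perm k < γ.perm ⟨l, hl⟩ := by
    intro l
    induction l with
    | zero => exact fun _ _ hk => absurd hk (Nat.not_lt_zero _)
    | succ l ih =>
      intro hl k hk
      have hstep : γ.perm ⟨l, by omega⟩ < γ.perm ⟨l + 1, hl⟩ := by
        refine lt_of_le_of_ne (not_lt.1 (h _ _ rfl)) fun hc => ?_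
        have := γ.perm.injective hc
        simp at this
      rcases Nat.lt_succ_iff_lt_or_eq.1 hk with hlt | rfl
      · exact (ih (by omega) k hlt).trans hstep
      · exact hstep
  have hmono : StrictMono γ.perm := fun k l hkl => key l l.isLt k hkl
  ext1 k
  refine le_antisymm ?_ hmono.le_apply
  have := hmono.le_apply (x := γ.perm k)
  rwa [γ.perm_perm] at this

/-- Both moves at a descent lower the displacement; a clan without descents has a strictly
increasing involution, which is the identity. -/
theorem descent_induction {P : Clan p q → Prop} (one : ∀ τ, τ.perm = 1 → P τ)
    (conj_swap : ∀ (τ : Clan p q) (a b : Fin (p + q)), (b : ℕ) = a + 1 → τ.perm b < τ.perm a →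
      τ.perm a ≠ b → P (τ.conj (Equiv.swap a b)) → P τ)
    (split : ∀ (τ : Clan p q) (a b : Fin (p + q)), (b : ℕ) = a + 1 → τ.perm a = b →
      ∀ ha : τ.perm a ≠ a, P (τ.split a ha) → P τ) (τ : Clan p q) : P τ := by
  by_cases h : ∃ a b : Fin (p + q), (b : ℕ) = a + 1 ∧ τ.perm b < τ.perm a
  · obtain ⟨a, b, hb, hdesc⟩ := h
    by_cases hab : τ.perm a = b
    · have ha : τ.perm a ≠ a := by
        rw [hab]
        intro hc
        have := congrArg Fin.val hc
        omega
      exact split τ a b hb hab ha (descent_induction one conj_swap split _)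
    · exact conj_swap τ a b hb hdesc hab (descent_induction one conj_swap split _)
  · push Not at h
    exact one τ (perm_eq_one_of_no_descent τ fun a b hb => not_lt.2 (h a b hb))
termination_by τ.displacement.toNat
decreasing_by
  · have := displacement_split_lt τ ha
    have := displacement_nonneg (τ.split a ha)
    omega
  · have := displacement_conj_swap_lt τ hb hdesc hab
    have := displacement_nonneg (τ.conj (Equiv.swap a b))
    omega

end Clan

/-! ### Matrices adapted to a clan. -/

open Matrix CompleteFlag

/-- The eigenvalue on `e_r` of the involution that is `1` on `E_p` and `-1` on `Ẽ_q`. -/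
def blockSign (p q : ℕ) (r : Fin (p + q)) : ℂ := if (r : ℕ) < p then 1 else -1

namespace Clan

variable {p q : ℕ}

/-- The sign of a position: `-1` at the fixed points decorated by `-`, and `1` elsewhere. -/
def sgn (γ : Clan p q) (k : Fin (p + q)) : ℂ := if k ∈ γ.minus then -1 else 1

theorem sgn_mul_self (γ : Clan p q) (k : Fin (p + q)) : γ.sgn k * γ.sgn k = 1 := by
  simp only [sgn]
  split_ifs <;> norm_num

theorem sgn_perm (γ : Clan p q) (k : Fin (p + q)) : γ.sgn (γ.perm k) = γ.sgn k := by
  by_cases h : γ.perm k = k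
  · rw [h]
  · have h1 : k ∉ γ.minus := fun hc => h (γ.mem_minus.1 hc).1
    have h2 : γ.perm k ∉ γ.minus := fun hc => h (by
      have := (γ.mem_minus.1 hc).1
      rw [γ.perm_perm] at this
      exact this.symm)
    simp [sgn, h1, h2]

theorem sgn_of_mem_plus (γ : Clan p q) {k : Fin (p + q)} (h : k ∈ γ.plus) : γ.sgn k = 1 :=
  if_neg fun hc => (γ.mem_minus.1 hc).2 h

theorem sgn_of_mem_minus (γ : Clan p q) {k : Fin (p + q)} (h : k ∈ γ.minus) : γ.sgn k = -1 :=
  if_pos h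

theorem sgn_of_perm_ne (γ : Clan p q) {k : Fin (p + q)} (h : γ.perm k ≠ k) : γ.sgn k = 1 :=
  if_neg fun hc => h (γ.mem_minus.1 hc).1

/-- The involution with eigenspaces `E_p` and `Ẽ_q` permutes the columns of `g`, up to sign, in the
way prescribed by the clan. -/
def Adapted (γ : Clan p q) (g : GL (Fin (p + q)) ℂ) : Prop :=
  ∀ r k, blockSign p q r * g r k = γ.sgn k * g r (γ.perm k)

/-- The flags spanned by the columns of matrices adapted to the clan. -/
def adaptedFlags (γ : Clan p q) : Set (CompleteFlag (p + q)) :=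
  {F | ∃ g, γ.Adapted g ∧ F = ofGL g}

variable {γ : Clan p q} {g g' : GL (Fin (p + q)) ℂ}

theorem Adapted.conj (hg : γ.Adapted g) {σ : Equiv.Perm (Fin (p + q))}
    (h : ∀ r k, g' r k = g r (σ k)) : (γ.conj σ).Adapted g' := by
  intro r k
  rw [h, h, conj_perm_apply, Equiv.Perm.inv_def, Equiv.apply_symm_apply, hg]
  simp only [sgn, mem_conj_minus]

/-- The involution exchanges the two columns of a pair, so their sum and difference are eigenvectors
for `1` and `-1`. Either sign of the difference is allowed so that both splittings of a pair are
covered. -/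
theorem Adapted.split (hg : γ.Adapted g) {a : Fin (p + q)} (ha : γ.perm a ≠ a)
    (h1 : ∀ r, g' r a = g r a + g r (γ.perm a)) (h2 : ∀ r, g' r (γ.perm a) = g r a - g r (γ.perm a) ∨
      g' r (γ.perm a) = g r (γ.perm a) - g r a)
    (h3 : ∀ r k, k ≠ a → k ≠ γ.perm a → g' r k = g r k) : (γ.split a ha).Adapted g' := by
  intro r k
  have e1 := hg r a
  have e2 := hg r (γ.perm a)
  rw [γ.perm_perm, sgn_perm] at e2
  rw [sgn_of_perm_ne γ ha] at e1 e2
  by_cases hk1 : k = a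
  · rw [hk1, split_perm_left, sgn_of_mem_plus _ (mem_split_plus_left γ ha), h1]
    linear_combination e1 + e2
  by_cases hk2 : k = γ.perm a
  · rw [hk2, split_perm_right, sgn_of_mem_minus _ (mem_split_minus_right γ ha)]
    rcases h2 r with h2 | h2
    · rw [h2]
      linear_combination e1 - e2
    · rw [h2]
      linear_combination e2 - e1
  have h4 : γ.perm k ≠ a := fun h => hk2 (by rw [← h, γ.perm_perm])
  have h5 : γ.perm k ≠ γ.perm a := fun h => hk1 (γ.perm.injective h)
  rw [split_perm_of_ne γ ha hk1 hk2, h3 r k hk1 hk2, h3 r _ h4 h5, hg]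
  simp only [sgn, mem_split_minus_of_ne γ ha hk1 hk2]

/-- The sum and the difference of eigenvectors for `1` and `-1` are exchanged by the involution. -/
theorem Adapted.join (hg : γ.Adapted g) {a b : Fin (p + q)} (ha : a ∈ γ.plus) (hb : b ∈ γ.minus)
    (h1 : ∀ r, g' r a = g r a + g r b) (h2 : ∀ r, g' r b = g r a - g r b)
    (h3 : ∀ r k, k ≠ a → k ≠ b → g' r k = g r k) : (γ.join a b ha hb).Adapted g' := by
  intro r k
  have ea := γ.perm_plus a ha
  have eb := (γ.mem_minus.1 hb).1
  have hab : a ≠ b := by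
    rintro rfl
    exact (γ.mem_minus.1 hb).2 ha
  have e1 := hg r a
  have e2 := hg r b
  rw [sgn_of_mem_plus γ ha, ea] at e1
  rw [sgn_of_mem_minus γ hb, eb] at e2
  by_cases hk1 : k = a
  · rw [hk1, sgn_of_perm_ne _ (by rw [join_perm_left]; exact hab.symm), join_perm_left, h1, h2]
    linear_combination e1 + e2
  by_cases hk2 : k = b
  · rw [hk2, sgn_of_perm_ne _ (by rw [join_perm_right]; exact hab), join_perm_right, h1, h2]
    linear_combination e1 - e2
  have h4 : γ.perm k ≠ a := fun h => hk1 (γ.perm.injective (by rw [h, ea]))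
  have h5 : γ.perm k ≠ b := fun h => hk2 (γ.perm.injective (by rw [h, eb]))
  rw [join_perm_of_ne γ ha hb hk1 hk2, h3 r k hk1 hk2, h3 r _ h4 h5, hg]
  simp only [sgn, mem_join_minus_of_ne γ ha hb hk1 hk2]

theorem Adapted.join_left (hg : γ.Adapted g) {a b : Fin (p + q)} (hab : a ≠ b) (ha : a ∈ γ.plus)
    (hb : b ∈ γ.minus) :
    (γ.join a b ha hb).Adapted (g * colGL hab (gl2 1 1 1 (-1) (by norm_num))) := by
  refine hg.join _ _ (fun r => ?_) (fun r => ?_) fun r k h1 h2 => ?_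
  · rw [mul_colGL_apply]
    simp
  · rw [mul_colGL_apply, if_neg hab.symm, if_pos rfl]
    simp [sub_eq_add_neg]
  · rw [mul_colGL_apply, if_neg h1, if_neg h2]

theorem Adapted.of_split {a : Fin (p + q)} (ha : γ.perm a ≠ a) (hg : (γ.split a ha).Adapted g) :
    γ.Adapted (g * colGL ha.symm (gl2 1 1 1 (-1) (by norm_num))) := by
  have h := hg.join_left ha.symm (mem_split_plus_left γ ha) (mem_split_minus_right γ ha)
  rwa [join_split] at h

theorem exists_adapted (γ : Clan p q) : ∃ g, γ.Adapted g := by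
  induction γ using descent_induction with
  | one τ hτ =>
    -- Without pairs the signature condition says that there are exactly `p` plus signs, so a
    -- permutation matrix can match them with the basis of `E_p`.
    have hcard : Fintype.card {k // k ∈ τ.plus} = Fintype.card {k : Fin (p + q) // (k : ℕ) < p} := by
      have h1 := τ.signature
      have h2 : (Finset.univ.filter fun k => τ.perm k = k ∧ k ∉ τ.plus) = τ.plusᶜ := by
        ext k
        simp [hτ]
      rw [h2, Finset.card_compl, Fintype.card_fin] at h1
      have h3 := Finset.card_le_univ τ.plus
      rw [Fintype.card_fin] at h3
      rw [Fintype.card_coe, Fintype.card_subtype, Fin.card_filter_val_lt]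
      rw [min_eq_right (by omega)]
      omega
    obtain ⟨e⟩ := Fintype.card_eq.1 hcard
    obtain ⟨g, hg⟩ := Matrix.exists_permuted_columns e.extendSubtype
      (1 : GL (Fin (p + q)) ℂ)
    refine ⟨g, fun r k => ?_⟩
    rw [hτ, Equiv.Perm.one_apply, hg]
    by_cases hrk : r = e.extendSubtype k
    · by_cases hk : k ∈ τ.plus
      · have := e.extendSubtype_mem k hk
        rw [← hrk] at this
        rw [sgn_of_mem_plus τ hk, blockSign, if_pos this]
      · have := e.extendSubtype_not_mem k hk
        rw [← hrk] at this
        rw [sgn_of_mem_minus τ (τ.mem_minus.2 ⟨by rw [hτ]; rfl, hk⟩), blockSign, if_neg this]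
    · have : (1 : GL (Fin (p + q)) ℂ) r (e.extendSubtype k) = 0 := by
        rw [Units.val_one, one_apply_ne hrk]
      rw [this, mul_zero, mul_zero]
  | conj_swap τ a b hb hdesc hne ih =>
    obtain ⟨g, hg⟩ := ih
    obtain ⟨g', hg'⟩ := Matrix.exists_permuted_columns (Equiv.swap a b) g
    refine ⟨g', ?_⟩
    have := hg.conj hg'
    rwa [conj_swap_conj_swap] at this
  | split τ a b hb hab ha ih =>
    obtain ⟨g, hg⟩ := ih
    exact ⟨_, hg.of_split ha⟩

/-! ### The line of flags through an adapted flag. -/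

section Line

variable {a b : Fin (p + q)}

/-- At a descent, a shear of the columns `a` and `b` extends to an adapted matrix. -/
theorem Adapted.shear (hg : γ.Adapted g) (hb : (b : ℕ) = a + 1) (hdesc : γ.perm b < γ.perm a)
    (hne : γ.perm a ≠ b) (t : ℂ) : ∃ g' : GL (Fin (p + q)) ℂ, γ.Adapted g' ∧
      ∀ r k, g' r k = g r k + (if k = a then t * g r b else 0) +
        if k = γ.perm a then t * (γ.sgn a * γ.sgn b) * g r (γ.perm b) else 0 := by
  have hab : a ≠ b := by
    rintro rfl
    omega
  have hperm : γ.perm a ≠ γ.perm b := fun h => hab (γ.perm.injective h)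
  have hne' : γ.perm b ≠ a := fun h => hne (by rw [← h, γ.perm_perm])
  -- Adding `t` times column `b` to column `a` must be accompanied by its image under the
  -- involution, on the mates of `a` and `b`. As `γ(a) ≠ b`, the sum `N` squares to zero and `1 + N`
  -- has inverse `1 - N`.
  let N : Matrix (Fin (p + q)) (Fin (p + q)) ℂ :=
    Matrix.single b a t + Matrix.single (γ.perm b) (γ.perm a) (t * (γ.sgn a * γ.sgn b))
  have hN : N * N = 0 := by
    simp only [N, add_mul, mul_add]
    rw [Matrix.single_mul_single_of_ne _ _ _ _ hab, Matrix.single_mul_single_of_ne _ _ _ _ hne'.symm,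
      Matrix.single_mul_single_of_ne _ _ _ _ hne, Matrix.single_mul_single_of_ne _ _ _ _ hperm]
    simp
  let u : GL (Fin (p + q)) ℂ := ⟨1 + N, 1 - N, by
    rw [add_mul, one_mul, mul_sub, mul_one, hN]
    abel, by
    rw [sub_mul, one_mul, mul_add, mul_one, hN]
    abel⟩
  have hu : ∀ r k, (g * u) r k = g r k + (if k = a then t * g r b else 0) +
      if k = γ.perm a then t * (γ.sgn a * γ.sgn b) * g r (γ.perm b) else 0 := by
    intro r k
    change ((g : Matrix (Fin (p + q)) (Fin (p + q)) ℂ) * (1 + N)) r k = _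
    rw [mul_add, mul_one, Matrix.add_apply, add_assoc]
    simp only [N]
    rw [mul_add, Matrix.add_apply]
    congr 2
    · split_ifs with h
      · rw [h, Matrix.mul_single_apply_same, mul_comm]
      · rw [Matrix.mul_single_apply_of_ne _ _ _ _ _ h]
    · split_ifs with h
      · rw [h, Matrix.mul_single_apply_same, mul_comm]
      · rw [Matrix.mul_single_apply_of_ne _ _ _ _ _ h]
  refine ⟨g * u, fun r k => ?_, hu⟩
  rw [hu, hu]
  have ek := hg r k
  have eb := hg r b
  have eb' := hg r (γ.perm b)
  rw [γ.perm_perm, sgn_perm] at eb'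
  have s1 := γ.sgn_mul_self a
  have s2 := γ.sgn_mul_self b
  have c1 : γ.perm k = a ↔ k = γ.perm a := ⟨fun h => by rw [← h, γ.perm_perm],
    fun h => by rw [h, γ.perm_perm]⟩
  have c2 : γ.perm k = γ.perm a ↔ k = a := γ.perm.injective.eq_iff
  simp only [c1, c2]
  by_cases h1 : k = a
  · by_cases h2 : k = γ.perm a
    · rw [if_pos h1, if_pos h2, if_pos h2, if_pos h1, h1]
      rw [h1] at ek
      linear_combination ek + t * eb + t * (γ.sgn a * γ.sgn b) * eb' -
        t * γ.sgn b * g r (γ.perm b) * s1 + t * γ.sgn a * g r b * s2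
    · rw [if_pos h1, if_neg h2, if_neg h2, if_pos h1, h1]
      rw [h1] at ek
      linear_combination ek + t * eb - t * γ.sgn b * g r (γ.perm b) * s1
  · by_cases h2 : k = γ.perm a
    · have h3 : γ.sgn k = γ.sgn a := by rw [h2, sgn_perm]
      rw [if_neg h1, if_pos h2, if_pos h2, if_neg h1, h3]
      rw [h3] at ek
      linear_combination ek + t * (γ.sgn a * γ.sgn b) * eb' + t * γ.sgn a * g r b * s2
    · rw [if_neg h1, if_neg h2, if_neg h2, if_neg h1]
      linear_combination ek

/-- The first column of `m`, up to scaling, is the homogeneous coordinate on the line. -/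
theorem ofGL_colGL_eq_of_proportional (g : GL (Fin (p + q)) ℂ) (hab : a ≠ b)
    (hb : (b : ℕ) = a + 1) {m m' : GL (Fin 2) ℂ} (c : ℂ) (h0 : m 0 0 = c * m' 0 0)
    (h1 : m 1 0 = c * m' 1 0) : ofGL (g * colGL hab m') = ofGL (g * colGL hab m) := by
  refine eq_ofGL_mul_colGL hab hb (fun j hj => ofGL_mul_colGL_space g hab hb m' hj) ?_
  have : (↑(g * colGL hab m') : Matrix (Fin (p + q)) (Fin (p + q)) ℂ).col a ∈
      (ofGL (g * colGL hab m')).space b.castSucc :=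
    col_mem_ofGL _ (by rw [Fin.val_castSucc]; omega)
  convert Submodule.smul_mem _ c this using 1
  ext r
  have := mul_colGL_apply g hab m' r a
  rw [if_pos rfl] at this
  simp only [Matrix.col_apply, Pi.add_apply, Pi.smul_apply, smul_eq_mul] at this ⊢
  rw [this, h0, h1]
  ring

/-- The shear by `m 1 0 / m 0 0` reaches the required point. Its companion term adds an earlier
column to a later one because `γ(b) < γ(a)`, so it leaves the spaces other than `F_b` alone. Only
the point `m 0 0 = 0` is missed. -/
theorem Adapted.colGL_mem_of_descent (hg : γ.Adapted g) (hab : a ≠ b) (hb : (b : ℕ) = a + 1)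
    (hdesc : γ.perm b < γ.perm a) (hne : γ.perm a ≠ b) {m : GL (Fin 2) ℂ} (hm : m 0 0 ≠ 0) :
    ofGL (g * colGL hab m) ∈ γ.adaptedFlags := by
  obtain ⟨g', hg', he⟩ := hg.shear hb hdesc hne (m 1 0 / m 0 0)
  refine ⟨g', hg', ?_⟩
  have hlt := Fin.lt_def.1 hdesc
  have hcol : ∀ k, (g' : Matrix (Fin (p + q)) (Fin (p + q)) ℂ).col k =
      (g : Matrix (Fin (p + q)) (Fin (p + q)) ℂ).col k +
      (if k = a then (m 1 0 / m 0 0) • (g : Matrix (Fin (p + q)) (Fin (p + q)) ℂ).col b else 0) +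
      if k = γ.perm a then (m 1 0 / m 0 0 * (γ.sgn a * γ.sgn b)) •
        (g : Matrix (Fin (p + q)) (Fin (p + q)) ℂ).col (γ.perm b) else 0 := by
    intro k
    ext r
    refine (he r k).trans ?_
    split_ifs <;> simp [Matrix.col]
  have hF : ∀ j : Fin (p + q + 1), (j : ℕ) ≠ b → (ofGL g').space j = (ofGL g).space j := by
    intro j hj
    refine space_eq_of_le (ofGL_space_le fun k hk => ?_)
    rw [hcol]
    refine add_mem (add_mem (col_mem_ofGL g hk) ?_) ?_
    · split_ifs with h
      · subst h
        exact Submodule.smul_mem _ _ (col_mem_ofGL g (by omega))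
      · exact zero_mem _
    · split_ifs with h
      · subst h
        exact Submodule.smul_mem _ _ (col_mem_ofGL g (by omega))
      · exact zero_mem _
  refine (eq_ofGL_mul_colGL hab hb hF ?_).symm
  have h1 : (g' : Matrix (Fin (p + q)) (Fin (p + q)) ℂ).col a ∈ (ofGL g').space b.castSucc :=
    col_mem_ofGL g' (by rw [Fin.val_castSucc]; omega)
  -- When `a` is fixed, the companion term also alters column `a`, but only by a vector of `F_a`.
  have h2 : (if a = γ.perm a then (m 1 0 / m 0 0 * (γ.sgn a * γ.sgn b)) •
        (g : Matrix (Fin (p + q)) (Fin (p + q)) ℂ).col (γ.perm b) else 0) ∈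
      (ofGL g').space b.castSucc := by
    split_ifs with h
    · have h3 := congrArg Fin.val h
      refine Submodule.smul_mem _ _ ((ofGL g').mono (a := a.castSucc) ?_ ?_)
      · rw [Fin.le_def, Fin.val_castSucc, Fin.val_castSucc]
        omega
      · rw [hF _ (by rw [Fin.val_castSucc]; omega)]
        exact col_mem_ofGL g (by rw [Fin.val_castSucc]; omega)
    · exact zero_mem _
  rw [hcol, if_pos rfl] at h1
  have h3 := Submodule.smul_mem _ (m 0 0) (sub_mem h1 h2)
  rwa [add_sub_cancel_right, smul_add, smul_smul, mul_div_cancel₀ _ hm] at h3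

/-- A symmetric matrix with equal diagonal entries commutes with the exchange of the two columns, so
it preserves adaptedness. It is singular exactly at the two points `m 0 0 = ± m 1 0`. -/
theorem Adapted.colGL_mem_of_pair (hg : γ.Adapted g) (hab : a ≠ b) (hb : (b : ℕ) = a + 1)
    (h : γ.perm a = b) {m : GL (Fin 2) ℂ} (hm : m 0 0 * m 0 0 - m 1 0 * m 1 0 ≠ 0) :
    ofGL (g * colGL hab m) ∈ γ.adaptedFlags := by
  refine ⟨g * colGL hab (gl2 (m 0 0) (m 1 0) (m 1 0) (m 0 0) hm), fun r k => ?_,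
    ofGL_colGL_eq_of_proportional g hab hb 1 ?_ ?_⟩
  · have ha' : γ.perm b = a := by rw [← h, γ.perm_perm]
    have e1 := hg r a
    have e2 := hg r b
    have hsa := γ.sgn_of_perm_ne (k := a) (by rw [h]; exact hab.symm)
    have hsb := γ.sgn_of_perm_ne (k := b) (by rw [ha']; exact hab)
    rw [h, hsa] at e1
    rw [ha', hsb] at e2
    rw [mul_colGL_apply, mul_colGL_apply]
    simp only [gl2_zero_zero, gl2_zero_one, gl2_one_zero, gl2_one_one]
    by_cases hk1 : k = a
    · rw [hk1, h, if_pos rfl, if_neg hab.symm, if_pos rfl, hsa]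
      linear_combination m 0 0 * e1 + m 1 0 * e2
    by_cases hk2 : k = b
    · rw [hk2, ha', if_neg hab.symm, if_pos rfl, if_pos rfl, hsb]
      linear_combination m 1 0 * e1 + m 0 0 * e2
    have h1 : γ.perm k ≠ a := fun hc => hk2 (by rw [← h, ← hc, γ.perm_perm])
    have h2 : γ.perm k ≠ b := fun hc => hk1 (by rw [← ha', ← hc, γ.perm_perm])
    rw [if_neg hk1, if_neg hk2, if_neg h1, if_neg h2, hg]
  · simp
  · simp

theorem Adapted.split_left (hg : γ.Adapted g) (hab : a ≠ b) (h : γ.perm a = b)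
    (ha : γ.perm a ≠ a) :
    (γ.split a ha).Adapted (g * colGL hab (gl2 1 1 1 (-1) (by norm_num))) := by
  refine hg.split ha (fun r => ?_) (fun r => .inl ?_) fun r k h1 h2 => ?_
  · rw [mul_colGL_apply, if_pos rfl, h]
    simp
  · rw [h, mul_colGL_apply, if_neg hab.symm, if_pos rfl]
    simp [sub_eq_add_neg]
  · rw [mul_colGL_apply, if_neg h1, if_neg (by rwa [← h])]

theorem Adapted.split_right (hg : γ.Adapted g) (hab : a ≠ b) (h : γ.perm a = b)
    (hb : γ.perm b ≠ b) :
    (γ.split b hb).Adapted (g * colGL hab (gl2 1 1 (-1) 1 (by norm_num))) := by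
  have h' : γ.perm b = a := by rw [← h, γ.perm_perm]
  refine hg.split hb (fun r => ?_) (fun r => .inr ?_) fun r k h1 h2 => ?_
  · rw [h', mul_colGL_apply, if_neg hab.symm, if_pos rfl]
    simp [add_comm]
  · rw [h', mul_colGL_apply, if_pos rfl]
    simp [sub_eq_add_neg]
  · rw [mul_colGL_apply, if_neg (by rwa [← h']), if_neg h1]

theorem Adapted.conj_swap (hg : γ.Adapted g) (hab : a ≠ b) :
    (γ.conj (Equiv.swap a b)).Adapted (g * colGL hab (gl2 0 1 1 0 (by norm_num))) := by
  refine hg.conj fun r k => ?_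
  rw [mul_colGL_apply, Equiv.swap_apply_def]
  split_ifs <;> simp

theorem Adapted.colGL_of_sgn_eq (hg : γ.Adapted g) (hab : a ≠ b) (ha : γ.perm a = a)
    (hb : γ.perm b = b) (h : γ.sgn a = γ.sgn b) (m : GL (Fin 2) ℂ) :
    γ.Adapted (g * colGL hab m) := by
  intro r k
  have e1 := hg r a
  have e2 := hg r b
  rw [ha] at e1
  rw [hb] at e2
  rw [mul_colGL_apply, mul_colGL_apply]
  by_cases hk1 : k = a
  · rw [hk1, ha, if_pos rfl]
    linear_combination m 0 0 * e1 + m 1 0 * e2 - m 1 0 * g r b * h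
  by_cases hk2 : k = b
  · rw [hk2, hb, if_neg hab.symm, if_pos rfl]
    linear_combination m 0 1 * e1 + m 1 1 * e2 + m 0 1 * g r a * h
  have h1 : γ.perm k ≠ a := fun hc => hk1 (γ.perm.injective (by rw [hc, ha]))
  have h2 : γ.perm k ≠ b := fun hc => hk2 (γ.perm.injective (by rw [hc, hb]))
  rw [if_neg hk1, if_neg hk2, if_neg h1, if_neg h2, hg]

/-- The points missed by the generic clan belong to the two splittings of a pair, or to the swapped
clan. -/
theorem Adapted.exists_colGL_mem_of_descent (hg : γ.Adapted g) (hab : a ≠ b)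
    (hb : (b : ℕ) = a + 1) (hdesc : γ.perm b < γ.perm a) (m : GL (Fin 2) ℂ) :
    ∃ δ : Clan p q, ofGL (g * colGL hab m) ∈ δ.adaptedFlags := by
  by_cases h : γ.perm a = b
  · by_cases hm : m 0 0 * m 0 0 - m 1 0 * m 1 0 = 0
    · have hm' : (m 0 0 - m 1 0) * (m 0 0 + m 1 0) = 0 := by linear_combination hm
      rcases mul_eq_zero.1 hm' with hm' | hm'
      · refine ⟨_, _, hg.split_left hab h (by rw [h]; exact hab.symm),
          (ofGL_colGL_eq_of_proportional g hab hb (m 0 0) ?_ ?_).symm⟩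
        · simp
        · rw [gl2_one_zero]
          linear_combination -hm'
      · refine ⟨_, _, hg.split_right hab h (by rw [← h, γ.perm_perm, h]; exact hab),
          (ofGL_colGL_eq_of_proportional g hab hb (m 0 0) ?_ ?_).symm⟩
        · simp
        · rw [gl2_one_zero]
          linear_combination hm'
    · exact ⟨γ, hg.colGL_mem_of_pair hab hb h hm⟩
  · by_cases hm : m 0 0 = 0
    · refine ⟨_, _, hg.conj_swap hab,
        (ofGL_colGL_eq_of_proportional g hab hb (m 1 0) ?_ ?_).symm⟩
      · simp [hm]
      · simp
    · exact ⟨γ, hg.colGL_mem_of_descent hab hb hdesc h hm⟩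

/-- Unless `a` and `b` carry equal signs, in which case the whole line stays adapted to `γ`, the
line also carries a matrix adapted to a clan with a descent at `a`, `b`. That descent clan serves as
base point: join opposite signs, or swap an ascent. -/
theorem Adapted.exists_colGL_mem (hg : γ.Adapted g) (hab : a ≠ b)
    (hb : (b : ℕ) = a + 1) (m : GL (Fin 2) ℂ) :
    ∃ δ : Clan p q, ofGL (g * colGL hab m) ∈ δ.adaptedFlags := by
  have transfer : ∀ (δ : Clan p q) (m' : GL (Fin 2) ℂ), δ.Adapted (g * colGL hab m') →
      δ.perm b < δ.perm a → ∃ δ : Clan p q, ofGL (g * colGL hab m) ∈ δ.adaptedFlags := by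
    intro δ m' hδ hdesc
    have := hδ.exists_colGL_mem_of_descent hab hb hdesc (m'⁻¹ * m)
    rwa [map_mul, map_inv, mul_assoc, mul_inv_cancel_left] at this
  rcases lt_trichotomy (γ.perm a) (γ.perm b) with hasc | heq | hdesc
  · by_cases hfix : γ.perm a = a ∧ γ.perm b = b
    · by_cases ha : a ∈ γ.plus
      · by_cases hbp : b ∈ γ.plus
        · exact ⟨γ, _, hg.colGL_of_sgn_eq hab hfix.1 hfix.2
            (by rw [sgn_of_mem_plus γ ha, sgn_of_mem_plus γ hbp]) m, rfl⟩
        · have hbm := γ.mem_minus.2 ⟨hfix.2, hbp⟩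
          refine transfer (γ.join a b ha hbm) _ (hg.join_left hab ha hbm) ?_
          rw [join_perm_left, join_perm_right, Fin.lt_def]
          omega
      · have ham := γ.mem_minus.2 ⟨hfix.1, ha⟩
        by_cases hbp : b ∈ γ.plus
        · refine transfer (γ.join b a hbp ham) (gl2 (-1) 1 1 1 (by norm_num)) ?_ ?_
          · refine hg.join _ _ (fun r => ?_) (fun r => ?_) fun r k h1 h2 => ?_
            · rw [mul_colGL_apply, if_neg hab.symm, if_pos rfl]
              simp [add_comm]
            · rw [mul_colGL_apply, if_pos rfl]
              simp [sub_eq_add_neg, add_comm]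
            · rw [mul_colGL_apply, if_neg h2, if_neg h1]
          · rw [join_perm_left, join_perm_right, Fin.lt_def]
            omega
        · exact ⟨γ, _, hg.colGL_of_sgn_eq hab hfix.1 hfix.2
            (by rw [sgn_of_mem_minus γ ham, sgn_of_mem_minus γ (γ.mem_minus.2 ⟨hfix.2, hbp⟩)]) m,
            rfl⟩
    · refine transfer _ _ (hg.conj_swap hab) ?_
      rw [conj_perm_apply, conj_perm_apply, Equiv.swap_apply_left, Equiv.swap_apply_right,
        Equiv.swap_inv]
      exact Fin.swap_lt_swap hb hasc hfix
  · exact absurd (γ.perm.injective heq) hab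
  · exact hg.exists_colGL_mem_of_descent hab hb hdesc m

end Line

/-! ### Adapted flags exhaust the flag variety and form `K`-orbits. -/

/-- The standard flag is adapted to the clan of `p` plus signs followed by `q` minus signs. The set
of all adapted flags is stable along lines, so `mem_of_stable` applies. -/
theorem exists_mem_adaptedFlags (F : CompleteFlag (p + q)) :
    ∃ γ : Clan p q, F ∈ γ.adaptedFlags := by
  have hne : ∃ γ : Clan p q, ofGL 1 ∈ γ.adaptedFlags := by
    let γ : Clan p q :=
      { perm := 1
        perm_perm := fun _ => rfl
        plus := Finset.univ.filter fun k : Fin (p + q) => (k : ℕ) < p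
        perm_plus := fun _ _ => rfl
        signature := by
          have h : (Finset.univ.filter fun k : Fin (p + q) =>
              (1 : Equiv.Perm (Fin (p + q))) k = k ∧
                k ∉ Finset.univ.filter fun k : Fin (p + q) => (k : ℕ) < p) =
              (Finset.univ.filter fun k : Fin (p + q) => (k : ℕ) < p)ᶜ := by
            ext k
            simp
          rw [h, Finset.card_compl, Fin.card_filter_val_lt, Fintype.card_fin,
            min_eq_right (by omega)]
          omega }
    refine ⟨γ, 1, fun r k => ?_, rfl⟩
    change _ = γ.sgn k * (1 : Matrix (Fin (p + q)) (Fin (p + q)) ℂ) r k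
    rw [Units.val_one]
    by_cases hrk : r = k
    · subst hrk
      congr 1
      by_cases hr : (r : ℕ) < p
      · rw [sgn_of_mem_plus γ (by simpa [γ] using hr), blockSign, if_pos hr]
      · rw [sgn_of_mem_minus γ (γ.mem_minus.2 ⟨rfl, by simpa [γ] using hr⟩), blockSign, if_neg hr]
    · rw [one_apply_ne hrk, mul_zero, mul_zero]
  refine mem_of_stable (S := {F | ∃ γ : Clan p q, F ∈ γ.adaptedFlags}) ?_ hne F
  rintro g a b hab hb ⟨γ, g', hg', h⟩ m
  obtain ⟨m', hm'⟩ := exists_eq_ofGL_mul_colGL hab hb (g := g') (F := ofGL (g * colGL hab m))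
    fun j hj => by rw [ofGL_mul_colGL_space g hab hb m hj, h]
  rw [hm']
  exact hg'.exists_colGL_mem hab hb m'

theorem mem_blockSubgroup_iff {k : GL (Fin (p + q)) ℂ} :
    k ∈ blockSubgroup p q ↔
      diagonal (blockSign p q) * (k : Matrix (Fin (p + q)) (Fin (p + q)) ℂ) =
        k * diagonal (blockSign p q) := by
  rw [← Matrix.ext_iff]
  simp only [diagonal_mul, mul_diagonal]
  refine forall₂_congr fun a b => ?_
  simp only [blockSign]
  by_cases ha : (a : ℕ) < p <;> by_cases hb : (b : ℕ) < p <;>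
    simp [ha, hb, self_eq_neg, neg_eq_self]

theorem adapted_iff : γ.Adapted g ↔
    diagonal (blockSign p q) * (g : Matrix (Fin (p + q)) (Fin (p + q)) ℂ) =
      g * of fun r k => if r = γ.perm k then γ.sgn k else 0 := by
  rw [← Matrix.ext_iff]
  refine forall₂_congr fun r k => ?_
  rw [diagonal_mul, mul_apply]
  simp [mul_comm]

theorem Adapted.mul_left (hg : γ.Adapted g) {k : GL (Fin (p + q)) ℂ}
    (hk : k ∈ blockSubgroup p q) : γ.Adapted (k * g) := by
  rw [adapted_iff] at hg ⊢
  rw [mem_blockSubgroup_iff] at hk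
  rw [Units.val_mul, ← mul_assoc, hk, mul_assoc, hg, mul_assoc]

/-- If `J g = g A` and `J g' = g' A` with the same signed permutation matrix `A`, then `g' g⁻¹`
commutes with `J`. -/
theorem adaptedFlags_eq_orbit (hg : γ.Adapted g) :
    γ.adaptedFlags = MulAction.orbit (blockSubgroup p q) (ofGL g) := by
  ext F
  constructor
  · rintro ⟨g', hg', rfl⟩
    refine ⟨⟨g' * g⁻¹, mem_blockSubgroup_iff.2 ?_⟩, ?_⟩
    · rw [adapted_iff] at hg hg'
      set A : Matrix (Fin (p + q)) (Fin (p + q)) ℂ := of fun r k =>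
        if r = γ.perm k then γ.sgn k else 0
      set D := diagonal (blockSign p q)
      have h1 : (↑g⁻¹ : Matrix (Fin (p + q)) (Fin (p + q)) ℂ) * D =
          A * (↑g⁻¹ : Matrix (Fin (p + q)) (Fin (p + q)) ℂ) := by
        calc (↑g⁻¹ : Matrix (Fin (p + q)) (Fin (p + q)) ℂ) * D
            = ↑g⁻¹ * (D * g) * ↑g⁻¹ := by simp [mul_assoc]
          _ = A * (↑g⁻¹ : Matrix (Fin (p + q)) (Fin (p + q)) ℂ) := by rw [hg]; simp [← mul_assoc]
      rw [Units.val_mul, ← mul_assoc, hg', mul_assoc, ← h1, mul_assoc]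
    · change (g' * g⁻¹) • ofGL g = _
      rw [smul_ofGL, inv_mul_cancel_right]
  · rintro ⟨k, rfl⟩
    exact ⟨k * g, hg.mul_left k.2, smul_ofGL _ _⟩

end Clan

/-! ### Dimensions attached to an adapted flag. -/

theorem mem_firstSpace {p q : ℕ} {x : Fin (p + q) → ℂ} :
    x ∈ firstSpace p q ↔ ∀ r, blockSign p q r * x r = 1 * x r := by
  constructor
  · intro h
    induction h using Submodule.span_induction with
    | mem x hx =>
      obtain ⟨k, hk, rfl⟩ := hx
      intro r
      by_cases hr : r = k
      · subst hr
        simp [blockSign, hk]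
      · simp [hr]
    | zero => simp
    | add x y _ _ hx hy =>
      intro r
      rw [Pi.add_apply, mul_add, hx, hy, mul_add]
    | smul c x _ hx =>
      intro r
      rw [Pi.smul_apply, smul_eq_mul, mul_left_comm, hx]
      ring
  · intro h
    rw [pi_eq_sum_univ' x]
    refine Submodule.sum_mem _ fun k _ => ?_
    by_cases hk : (k : ℕ) < p
    · refine Submodule.smul_mem _ _ (Submodule.subset_span ⟨k, hk, ?_⟩)
      ext r
      simp [Pi.single_apply, eq_comm]
    · have := h k
      rw [blockSign, if_neg hk] at this
      have h0 : x k = 0 := by linear_combination (-1 / 2 : ℂ) * this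
      rw [h0, zero_smul]
      exact zero_mem _

theorem mem_lastSpace {p q : ℕ} {x : Fin (p + q) → ℂ} :
    x ∈ lastSpace p q ↔ ∀ r, blockSign p q r * x r = -1 * x r := by
  constructor
  · intro h
    induction h using Submodule.span_induction with
    | mem x hx =>
      obtain ⟨k, hk, rfl⟩ := hx
      intro r
      by_cases hr : r = k
      · subst hr
        simp [blockSign, not_lt.2 hk]
      · simp [hr]
    | zero => simp
    | add x y _ _ hx hy =>
      intro r
      rw [Pi.add_apply, mul_add, hx, hy, mul_add]
    | smul c x _ hx =>
      intro r
      rw [Pi.smul_apply, smul_eq_mul, mul_left_comm, hx]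
      ring
  · intro h
    rw [pi_eq_sum_univ' x]
    refine Submodule.sum_mem _ fun k _ => ?_
    by_cases hk : (k : ℕ) < p
    · have := h k
      rw [blockSign, if_pos hk] at this
      have h0 : x k = 0 := by linear_combination (1 / 2 : ℂ) * this
      rw [h0, zero_smul]
      exact zero_mem _
    · refine Submodule.smul_mem _ _ (Submodule.subset_span ⟨k, not_lt.1 hk, ?_⟩)
      ext r
      simp [Pi.single_apply, eq_comm]

theorem firstProj_apply {p q : ℕ} (x : Fin (p + q) → ℂ) (r : Fin (p + q)) :
    firstProj p q x r = (x r + blockSign p q r * x r) / 2 := by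
  change (if (r : ℕ) < p then x r else 0) = _
  rw [blockSign]
  split_ifs <;> ring

namespace Clan

variable {p q : ℕ} {γ : Clan p q} {g : GL (Fin (p + q)) ℂ}

theorem Adapted.blockSign_mul_mulVec (hg : γ.Adapted g) (a : Fin (p + q) → ℂ) :
    (fun r => blockSign p q r * (g : Matrix (Fin (p + q)) (Fin (p + q)) ℂ).mulVec a r) =
      (g : Matrix (Fin (p + q)) (Fin (p + q)) ℂ).mulVec fun k => γ.sgn k * a (γ.perm k) := by
  ext r
  rw [mulVec, mulVec, dotProduct, dotProduct, Finset.mul_sum, ← Equiv.sum_comp γ.perm]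
  refine Finset.sum_congr rfl fun k _ => ?_
  rw [← mul_assoc, hg, γ.perm_perm, sgn_perm]
  ring

/-- The dimension of the intersection of a space of an adapted flag with an eigenspace. -/
theorem Adapted.finrank_inf (hg : γ.Adapted g) {σ : ℂ} (hσ : σ * σ = 1)
    {W : Submodule ℂ (Fin (p + q) → ℂ)} (hW : ∀ x, x ∈ W ↔ ∀ r, blockSign p q r * x r = σ * x r)
    {T : Finset (Fin (p + q))} {i : Fin (p + q + 1)}
    (hT : ∀ k, k ∈ T ↔ (k : ℕ) < i ∧ ((γ.perm k = k ∧ γ.sgn k = σ) ∨ γ.perm k < k)) :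
    Module.finrank ℂ ↥((ofGL g).space i ⊓ W) = T.card := by
  let M := (g : Matrix (Fin (p + q)) (Fin (p + q)) ℂ)
  have hinj : Function.Injective M.mulVec := mulVec_injective_of_isUnit g.isUnit
  -- Coordinates of the eigenvectors indexed by `T`: `e_k` at a sign equal to `σ`, and `e_k + σ
  -- e_{γ(k)}` at the closing end `k` of a pair. Indexing by closing ends makes the support lie
  -- below `i` and the restriction to `T` the identity matrix.
  let c : Fin (p + q) → Fin (p + q) → ℂ := fun k l =>
    (if l = k then 1 else 0) + if γ.perm l = k ∧ l ≠ k then σ else 0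
  have hmem : ∀ a : Fin (p + q) → ℂ, M.mulVec a ∈ W ↔ ∀ k, γ.sgn k * a (γ.perm k) = σ * a k := by
    intro a
    rw [hW, ← funext_iff (f := fun r => blockSign p q r * M.mulVec a r)
      (g := fun r => σ * M.mulVec a r), hg.blockSign_mul_mulVec]
    have : (fun r => σ * M.mulVec a r) = M.mulVec (σ • a) := by
      rw [mulVec_smul]
      rfl
    rw [this, hinj.eq_iff, funext_iff]
    rfl
  have hsgn : ∀ k l, k ∈ T → γ.perm l = k → l ≠ k → γ.sgn l = 1 := by
    rintro k l hk rfl hne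
    exact γ.sgn_of_perm_ne hne.symm
  have hc : ∀ k ∈ T, ∀ l ∈ T, c k l = if l = k then 1 else 0 := by
    intro k hk l hl
    have h1 := ((hT k).1 hk).2
    have h2 := ((hT l).1 hl).2
    have : ¬ (γ.perm l = k ∧ l ≠ k) := by
      rintro ⟨rfl, hne⟩
      rw [γ.perm_perm] at h1
      rcases h2 with h2 | h2
      · exact hne h2.1.symm
      · rcases h1 with h1 | h1
        · exact hne h1.1
        · exact lt_asymm h1 h2
    simp only [c, if_neg this, add_zero]
  have hli : LinearIndependent ℂ fun k : T => M.mulVec (c k) := by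
    have h1 : LinearIndependent ℂ fun k : T => c k := by
      rw [Fintype.linearIndependent_iff]
      intro b hb l
      have := congrFun hb l
      rw [Finset.sum_apply, Finset.sum_eq_single l] at this
      · rw [Pi.smul_apply, hc l l.2 l l.2, if_pos rfl, smul_eq_mul, mul_one] at this
        exact this
      · intro k _ hkl
        rw [Pi.smul_apply, hc k k.2 l l.2, if_neg (fun h => hkl (Subtype.ext h.symm)), smul_zero]
      · simp
    exact h1.map' (Matrix.toLin' M) (LinearMap.ker_eq_bot.2 hinj)
  have hspan : (ofGL g).space i ⊓ W = Submodule.span ℂ (Set.range fun k : T => M.mulVec (c k)) := by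
    refine le_antisymm ?_ (Submodule.span_le.2 ?_)
    · rintro x ⟨hx, hxW⟩
      obtain ⟨a, ha, rfl⟩ := mem_ofGL.1 hx
      have hxW' := (hmem a).1 hxW
      have hsum : a = ∑ k : T, a k • c k := by
        ext l
        rw [Finset.sum_apply]
        simp only [Pi.smul_apply, smul_eq_mul]
        rw [Finset.sum_coe_sort T fun k => a k * c k l]
        have e1 := hxW' l
        have zero_of : ∀ l : Fin (p + q), ¬ (l : ℕ) < i → a l = 0 := fun l hl => ha l (by omega)
        by_cases hl : l ∈ T
        · rw [Finset.sum_eq_single l]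
          · rw [hc l hl l hl, if_pos rfl, mul_one]
          · intro k hk hkl
            rw [hc k hk l hl, if_neg hkl.symm, mul_zero]
          · exact fun h => absurd hl h
        · by_cases hl' : γ.perm l ∈ T
          · have hne : l ≠ γ.perm l := fun h => hl (by rwa [h])
            rw [Finset.sum_eq_single (γ.perm l)]
            · have hcσ : c (γ.perm l) l = σ := by simp [c, hne]
              rw [hcσ]
              rw [sgn_of_perm_ne γ hne.symm] at e1
              linear_combination (-σ) * e1 - a l * hσ
            · intro k hk hkl
              simp only [c]
              rw [if_neg, if_neg, add_zero, mul_zero]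
              · rintro ⟨h, -⟩
                exact hkl h.symm
              · rintro rfl
                exact hl hk
            · exact fun h => absurd hl' h
          · rw [Finset.sum_eq_zero]
            · rw [hT] at hl hl'
              rw [γ.perm_perm] at hl'
              rcases lt_trichotomy (γ.perm l) l with h | h | h
              · exact zero_of l fun hlt => hl ⟨hlt, .inr h⟩
              · by_cases hlt : (l : ℕ) < i
                · have hs : γ.sgn l ≠ σ := fun hs => hl ⟨hlt, .inl ⟨h, hs⟩⟩
                  rw [h] at e1
                  have : (γ.sgn l - σ) * a l = 0 := by linear_combination e1
                  exact (mul_eq_zero.1 this).resolve_left (sub_ne_zero.2 hs)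
                · exact zero_of l hlt
              · have h1 : a (γ.perm l) = 0 := zero_of _ fun hlt => hl' ⟨hlt, .inr h⟩
                rw [h1] at e1
                linear_combination (-σ) * e1 - a l * hσ
            · intro k hk
              simp only [c]
              rw [if_neg, if_neg, add_zero, mul_zero]
              · rintro ⟨rfl, -⟩
                exact hl' hk
              · rintro rfl
                exact hl hk
      rw [hsum]
      change Matrix.toLin' M _ ∈ _
      rw [map_sum]
      refine Submodule.sum_mem _ fun k _ => ?_
      rw [map_smul]
      exact Submodule.smul_mem _ _ (Submodule.subset_span ⟨k, rfl⟩)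
    · rintro _ ⟨k, rfl⟩
      have hk := (hT k).1 k.2
      refine ⟨mem_ofGL.2 ⟨c k, fun l hl => ?_, rfl⟩, (hmem _).2 fun l => ?_⟩
      · simp only [c]
        rw [if_neg, if_neg, add_zero]
        · rintro ⟨h, hne⟩
          have h2 : γ.perm k = l := by rw [← h, γ.perm_perm]
          rcases hk.2 with h3 | h3
          · exact hne (h2.symm.trans h3.1)
          · rw [h2] at h3
            have := Fin.lt_def.1 h3
            omega
        · rintro rfl
          omega
      · simp only [c, γ.perm_perm]
        by_cases h1 : l = k
        · by_cases h2 : γ.perm l = l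
          · have h3 : γ.sgn l = σ := by
              rcases hk.2 with h4 | h4
              · rw [h1]
                exact h4.2
              · rw [← h1, h2] at h4
                exact absurd h4 (lt_irrefl _)
            rw [h2, h3]
          · rw [sgn_of_perm_ne γ h2]
            have h3 : γ.perm l ≠ k := by rwa [← h1]
            rw [if_neg h3, if_pos ⟨h1, h3⟩, if_pos h1, if_neg fun h => h3 h.1]
            ring
        · by_cases h2 : γ.perm l = k
          · rw [sgn_of_perm_ne γ (by rw [h2]; exact fun h => h1 h.symm)]
            simp [h1, h2, hσ]
          · simp [h1, h2]
  rw [hspan, finrank_span_eq_card hli, Fintype.card_coe]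

theorem Adapted.finrank_inf_firstSpace (hg : γ.Adapted g) (i : Fin (p + q + 1)) :
    Module.finrank ℂ ↥((ofGL g).space i ⊓ firstSpace p q) = γ.plusRank i := by
  rw [plusRank_eq]
  refine hg.finrank_inf (one_mul 1) (fun x => mem_firstSpace) fun k => ?_
  rw [Finset.mem_filter]
  refine (and_iff_right (Finset.mem_univ k)).trans (and_congr_right fun _ => or_congr_left ?_)
  constructor
  · exact fun h => ⟨γ.perm_plus k h, γ.sgn_of_mem_plus h⟩
  · rintro ⟨h1, h2⟩
    by_contra hc
    rw [γ.sgn_of_mem_minus (γ.mem_minus.2 ⟨h1, hc⟩)] at h2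
    norm_num at h2

theorem Adapted.finrank_inf_lastSpace (hg : γ.Adapted g) (i : Fin (p + q + 1)) :
    Module.finrank ℂ ↥((ofGL g).space i ⊓ lastSpace p q) = γ.minusRank i := by
  rw [minusRank_eq]
  refine hg.finrank_inf (σ := -1) (by norm_num) (fun x => mem_lastSpace) fun k => ?_
  rw [Finset.mem_filter]
  refine (and_iff_right (Finset.mem_univ k)).trans (and_congr_right fun _ => or_congr_left ?_)
  constructor
  · exact fun h => ⟨(γ.mem_minus.1 h).1, γ.sgn_of_mem_minus h⟩
  · rintro ⟨h1, h2⟩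
    refine γ.mem_minus.2 ⟨h1, fun hc => ?_⟩
    rw [γ.sgn_of_mem_plus hc] at h2
    norm_num at h2

/-- Since `π = (1 + J) / 2`, the projection of column `k` is half the sum of column `k` and `±`
column `γ(k)`. Modulo `F_j`, the image of `F_i` is thus spanned by the mates beyond `j` of the
columns before `i`. -/
theorem Adapted.finrank_map_sup (hg : γ.Adapted g) {i j : Fin (p + q + 1)} (hij : i ≤ j) :
    Module.finrank ℂ ↥(((ofGL g).space i).map (firstProj p q) ⊔ (ofGL g).space j) =
      j + γ.pairRank i j := by
  have hij' := Fin.le_def.1 hij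
  let M := (g : Matrix (Fin (p + q)) (Fin (p + q)) ℂ)
  let U : Finset (Fin (p + q)) :=
    Finset.univ.filter fun k => (k : ℕ) < j ∨ (γ.perm k : ℕ) < i
  have hproj : ∀ k, firstProj p q (M.col k) = (1 / 2 : ℂ) • (M.col k + γ.sgn k • M.col (γ.perm k)) := by
    intro k
    ext r
    have := hg r k
    simp only [firstProj_apply, Matrix.col_apply, Pi.smul_apply, Pi.add_apply, smul_eq_mul]
    change _ = 1 / 2 * (g r k + γ.sgn k * g r (γ.perm k))
    rw [← this]
    change (g r k + blockSign p q r * g r k) / 2 = _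
    ring
  have hspan : ((ofGL g).space i).map (firstProj p q) ⊔ (ofGL g).space j =
      Submodule.span ℂ (Set.range fun k : U => M.col k) := by
    have hU : ∀ k : Fin (p + q), ((k : ℕ) < j ∨ (γ.perm k : ℕ) < i) →
        M.col k ∈ Submodule.span ℂ (Set.range fun k : U => M.col k) := fun k hk =>
      Submodule.subset_span ⟨⟨k, by simpa [U] using hk⟩, rfl⟩
    refine le_antisymm (sup_le ?_ (ofGL_space_le fun k hk => hU k (.inl hk)))
      (Submodule.span_le.2 ?_)
    · rw [Submodule.map_le_iff_le_comap]
      refine ofGL_space_le fun k hk => ?_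
      rw [Submodule.mem_comap]
      change firstProj p q (M.col k) ∈ _
      rw [hproj]
      refine Submodule.smul_mem _ _ (add_mem (hU k (.inl (by omega))) (Submodule.smul_mem _ _ ?_))
      exact hU _ (.inr (by rwa [γ.perm_perm]))
    · rintro _ ⟨⟨k, hk⟩, rfl⟩
      have hk' : (k : ℕ) < j ∨ (γ.perm k : ℕ) < i := by simpa [U] using hk
      by_cases hkj : (k : ℕ) < j
      · exact Submodule.mem_sup_right (col_mem_ofGL g hkj)
      · have hki := hk'.resolve_left hkj
        have h1 := Submodule.mem_map_of_mem (f := firstProj p q) (col_mem_ofGL g hki)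
        have h2 := col_mem_ofGL g (j := j) (k := γ.perm k) (by omega)
        change firstProj p q (M.col (γ.perm k)) ∈ _ at h1
        rw [hproj, γ.perm_perm, sgn_perm] at h1
        have h3 := Submodule.smul_mem _ (γ.sgn k) (sub_mem
          (Submodule.smul_mem _ (2 : ℂ) (Submodule.mem_sup_left (T := (ofGL g).space j) h1))
          (Submodule.mem_sup_right (S := ((ofGL g).space i).map (firstProj p q)) h2))
        have h4 : M.col k = γ.sgn k • ((2 : ℂ) • (1 / 2 : ℂ) •
          (M.col (γ.perm k) + γ.sgn k • M.col k) - M.col (γ.perm k)) := by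
          rw [smul_smul, show (2 : ℂ) * (1 / 2) = 1 by norm_num, one_smul, add_sub_cancel_left,
            smul_smul, γ.sgn_mul_self, one_smul]
        change M.col k ∈ _
        rw [h4]
        exact h3
  have hli : LinearIndependent ℂ fun k : U => M.col k :=
    (Matrix.GeneralLinearGroup.linearIndependent_col g).comp _ Subtype.val_injective
  rw [hspan, finrank_span_eq_card hli, Fintype.card_coe, pairRank_eq γ hij']
  have hU : U = (Finset.univ.filter fun k : Fin (p + q) => (k : ℕ) < j) ∪
      Finset.univ.filter fun k : Fin (p + q) => (γ.perm k : ℕ) < i ∧ (j : ℕ) ≤ k := by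
    ext k
    simp only [U, Finset.mem_union, Finset.mem_filter, Finset.mem_univ, true_and]
    omega
  rw [hU, Finset.card_union_of_disjoint, Fin.card_filter_val_lt, min_eq_right (by omega)]
  · congr 1
    refine Finset.card_equiv γ.perm fun k => ?_
    simp only [Finset.mem_filter, Finset.mem_univ, true_and, γ.perm_perm]
  · rw [Finset.disjoint_left]
    intro k hk hk'
    simp only [Finset.mem_filter, Finset.mem_univ, true_and] at hk hk'
    omega

theorem adaptedFlags_subset_orbit (γ : Clan p q) : γ.adaptedFlags ⊆ γ.orbit := by
  rintro _ ⟨g, hg, rfl⟩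
  exact ⟨hg.finrank_inf_firstSpace, hg.finrank_inf_lastSpace,
    fun i j hij => hg.finrank_map_sup hij.le⟩

theorem RankEqOff.of_orbit {m : ℕ} {γ δ : Clan p q} {F F' : CompleteFlag (p + q)}
    (hF : F ∈ γ.orbit) (hF' : F' ∈ δ.orbit)
    (h : ∀ j : Fin (p + q + 1), (j : ℕ) ≠ m → F.space j = F'.space j) : γ.RankEqOff m δ := by
  refine ⟨fun i hi him => ?_, fun i hi him => ?_, fun i j hij hj him hjm => ?_⟩
  · have h1 := hF.1 ⟨i, by omega⟩
    rw [h ⟨i, by omega⟩ him, hF'.1] at h1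
    exact h1.symm
  · have h1 := hF.2.1 ⟨i, by omega⟩
    rw [h ⟨i, by omega⟩ him, hF'.2.1] at h1
    exact h1.symm
  · have h1 := hF.2.2 ⟨i, by omega⟩ ⟨j, by omega⟩ hij
    rw [h ⟨i, by omega⟩ him, h ⟨j, by omega⟩ hjm, hF'.2.2 ⟨i, by omega⟩ ⟨j, by omega⟩ hij] at h1
    simp only at h1
    omega

/-- A flag in `Q_γ` is adapted to some `δ`; it computes the ranks of both clans, so `δ = γ`. -/
theorem orbit_eq_adaptedFlags (γ : Clan p q) : γ.orbit = γ.adaptedFlags := by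
  refine Set.Subset.antisymm (fun F hF => ?_) γ.adaptedFlags_subset_orbit
  obtain ⟨δ, hδ⟩ := exists_mem_adaptedFlags F
  -- The excluded index is out of range, so all ranks agree.
  have h := RankEqOff.of_orbit (m := p + q + 1) hF (δ.adaptedFlags_subset_orbit hδ) fun _ _ => rfl
  rwa [eq_of_rank_eq (γ := γ) (δ := δ) (fun i hi => h.plus i hi (by omega))
    fun i j hij hj => h.pair_le hij hj (by omega) (by omega)]

end Clan

/-! ### Zariski-closed conditions on matrices and flags. -/

open scoped Topology

section Zariski

variable {n : ℕ}

/-- The algebra of polynomial functions in the matrix entries. -/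
def glPolynomials (n : ℕ) : Subalgebra ℂ (GL (Fin n) ℂ → ℂ) :=
  Algebra.adjoin ℂ (Set.range fun (x : Fin n × Fin n) (g : GL (Fin n) ℂ) => g x.1 x.2)

theorem entry_mem_glPolynomials (r k : Fin n) :
    (fun g : GL (Fin n) ℂ => g r k) ∈ glPolynomials n :=
  Algebra.subset_adjoin ⟨(r, k), rfl⟩

theorem mem_glPolynomials_iff {f : GL (Fin n) ℂ → ℂ} :
    f ∈ glPolynomials n ↔ ∃ P : MvPolynomial (Fin n × Fin n) ℂ,
      ∀ g : GL (Fin n) ℂ, MvPolynomial.eval (fun x => g x.1 x.2) P = f g := by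
  constructor
  · intro hf
    induction hf using Algebra.adjoin_induction with
    | mem f hf =>
      obtain ⟨x, rfl⟩ := hf
      exact ⟨MvPolynomial.X x, fun g => MvPolynomial.eval_X x⟩
    | algebraMap c => exact ⟨MvPolynomial.C c, fun g => MvPolynomial.eval_C c⟩
    | add f f' _ _ h h' =>
      obtain ⟨P, hP⟩ := h
      obtain ⟨P', hP'⟩ := h'
      exact ⟨P + P', fun g => by rw [map_add, hP, hP', Pi.add_apply]⟩
    | mul f f' _ _ h h' =>
      obtain ⟨P, hP⟩ := h
      obtain ⟨P', hP'⟩ := h'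
      exact ⟨P * P', fun g => by rw [map_mul, hP, hP', Pi.mul_apply]⟩
  · rintro ⟨P, hP⟩
    obtain rfl : (fun g : GL (Fin n) ℂ => MvPolynomial.eval (fun x => g x.1 x.2) P) = f :=
      funext hP
    clear hP
    induction P using MvPolynomial.induction_on with
    | C c =>
      simp only [MvPolynomial.eval_C]
      exact (glPolynomials n).algebraMap_mem c
    | add P P' h h' =>
      simp only [map_add]
      exact add_mem h h'
    | mul_X P x h =>
      simp only [map_mul, MvPolynomial.eval_X]
      exact mul_mem h (entry_mem_glPolynomials x.1 x.2)

theorem isClosed_zariskiGL_iff {Z : Set (GL (Fin n) ℂ)} :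
    IsClosed[zariskiGL n] Z ↔ ∃ S : Set (MvPolynomial (Fin n × Fin n) ℂ),
      Z = {g | ∀ f ∈ S, MvPolynomial.eval (fun x => g x.1 x.2) f = 0} := by
  rw [← @isOpen_compl_iff _ _ (zariskiGL n)]
  change Zᶜᶜ ∈ _ ↔ _
  rw [compl_compl]
  rfl

theorem isClosed_zeroLocus {A : Set (GL (Fin n) ℂ → ℂ)} (hA : ∀ f ∈ A, f ∈ glPolynomials n) :
    IsClosed[zariskiGL n] {g | ∀ f ∈ A, f g = 0} := by
  refine isClosed_zariskiGL_iff.2 ⟨{P | ∃ f ∈ A, ∀ g : GL (Fin n) ℂ,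
    MvPolynomial.eval (fun x => g x.1 x.2) P = f g}, ?_⟩
  ext g
  constructor
  · rintro h P ⟨f, hf, hP⟩
    rw [hP]
    exact h f hf
  · intro h f hf
    obtain ⟨P, hP⟩ := mem_glPolynomials_iff.1 (hA f hf)
    rw [← hP]
    exact h P ⟨f, hf, hP⟩

theorem exists_eq_zeroLocus {Z : Set (GL (Fin n) ℂ)} (hZ : IsClosed[zariskiGL n] Z) :
    ∃ A : Set (GL (Fin n) ℂ → ℂ), (∀ f ∈ A, f ∈ glPolynomials n) ∧
      Z = {g | ∀ f ∈ A, f g = 0} := by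
  obtain ⟨S, rfl⟩ := isClosed_zariskiGL_iff.1 hZ
  refine ⟨{f | ∃ P ∈ S, ∀ g : GL (Fin n) ℂ, MvPolynomial.eval (fun x => g x.1 x.2) P = f g},
    fun f ⟨P, _, hP⟩ => mem_glPolynomials_iff.2 ⟨P, hP⟩, ?_⟩
  ext g
  constructor
  · rintro h f ⟨P, hPS, hP⟩
    rw [← hP]
    exact h P hPS
  · intro h P hPS
    have hP : (fun g' : GL (Fin n) ℂ => MvPolynomial.eval (fun x => g' x.1 x.2) P) g = 0 :=
      h _ ⟨P, hPS, fun _ => rfl⟩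
    exact hP

theorem comp_mul_right_mem_glPolynomials {f : GL (Fin n) ℂ → ℂ}
    (hf : f ∈ glPolynomials n) (h : GL (Fin n) ℂ) :
    (fun g => f (g * h)) ∈ glPolynomials n := by
  induction hf using Algebra.adjoin_induction with
  | mem f hf =>
    obtain ⟨x, rfl⟩ := hf
    have : (fun g : GL (Fin n) ℂ => (g * h) x.1 x.2) =
        ∑ s, h s x.2 • fun g : GL (Fin n) ℂ => g x.1 s := by
      ext g
      rw [Units.val_mul, mul_apply, Finset.sum_apply]
      exact Finset.sum_congr rfl fun s _ => mul_comm _ _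
    change (fun g : GL (Fin n) ℂ => (g * h) x.1 x.2) ∈ _
    rw [this]
    exact sum_mem fun s _ => Subalgebra.smul_mem _ (entry_mem_glPolynomials _ _) _
  | algebraMap c => exact (glPolynomials n).algebraMap_mem c
  | add f f' _ _ h h' => exact add_mem h h'
  | mul f f' _ _ h h' => exact mul_mem h h'

theorem isClosed_preimage_mul_right {Z : Set (GL (Fin n) ℂ)} (hZ : IsClosed[zariskiGL n] Z)
    (h : GL (Fin n) ℂ) : IsClosed[zariskiGL n] {g | g * h ∈ Z} := by
  obtain ⟨A, hA, rfl⟩ := exists_eq_zeroLocus hZ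
  convert isClosed_zeroLocus (A := (fun (f : GL (Fin n) ℂ → ℂ) g => f (g * h)) '' A) ?_ using 1
  · ext g
    simp
  · rintro _ ⟨f, hf, rfl⟩
    exact comp_mul_right_mem_glPolynomials (hA f hf) h

/-- A polynomial curve that lies generically in a closed set lies in it entirely. -/
theorem mem_of_curve {Z : Set (GL (Fin n) ℂ)} (hZ : IsClosed[zariskiGL n] Z) {c : ℂ → GL (Fin n) ℂ}
    (hc : ∀ r k, ∃ P : Polynomial ℂ, ∀ t, c t r k = P.eval t) {d : Polynomial ℂ} (hd : d ≠ 0)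
    (h : ∀ t, d.eval t ≠ 0 → c t ∈ Z) (t : ℂ) : c t ∈ Z := by
  obtain ⟨A, hA, rfl⟩ := exists_eq_zeroLocus hZ
  have key : ∀ f ∈ glPolynomials n, ∃ P : Polynomial ℂ, ∀ t, f (c t) = P.eval t := by
    intro f hf
    induction hf using Algebra.adjoin_induction with
    | mem f hf =>
      obtain ⟨x, rfl⟩ := hf
      exact hc x.1 x.2
    | algebraMap c => exact ⟨Polynomial.C c, fun t => Polynomial.eval_C.symm⟩
    | add f f' _ _ h h' =>
      obtain ⟨P, hP⟩ := h
      obtain ⟨P', hP'⟩ := h'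
      exact ⟨P + P', fun t => by rw [Polynomial.eval_add, ← hP, ← hP', Pi.add_apply]⟩
    | mul f f' _ _ h h' =>
      obtain ⟨P, hP⟩ := h
      obtain ⟨P', hP'⟩ := h'
      exact ⟨P * P', fun t => by rw [Polynomial.eval_mul, ← hP, ← hP', Pi.mul_apply]⟩
  intro f hf
  obtain ⟨P, hP⟩ := key f (hA f hf)
  -- The product vanishes at every point: where `d` does not, the curve lies in the zero locus.
  have hPd : P * d = 0 := by
    refine Polynomial.funext fun s => ?_
    rw [Polynomial.eval_mul, Polynomial.eval_zero]
    by_cases hs : d.eval s = 0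
    · rw [hs, mul_zero]
    · rw [← hP, h s hs f hf, zero_mul]
  rw [hP, (mul_eq_zero.1 hPd).resolve_right hd, Polynomial.eval_zero]

/-- Compressing by arbitrary `A` and `B` plays the role of minors: if the rank exceeds `r`, choose
`B` so that `M * B` has `r + 1` independent columns, and take `A` to be a left inverse. -/
theorem Matrix.rank_le_iff_det_eq_zero {m k : Type*} [Fintype m] [Fintype k] [DecidableEq m]
    [DecidableEq k] (M : Matrix m k ℂ) (r : ℕ) :
    M.rank ≤ r ↔ ∀ (A : Matrix (Fin (r + 1)) m ℂ) (B : Matrix k (Fin (r + 1)) ℂ),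
      (A * M * B).det = 0 := by
  constructor
  · intro h A B
    by_contra hdet
    have h1 := rank_of_isUnit (A * M * B) ((isUnit_iff_isUnit_det _).2 (isUnit_iff_ne_zero.2 hdet))
    have h2 := (rank_mul_le_left (A * M) B).trans (rank_mul_le_right A M)
    rw [h1, Fintype.card_fin] at h2
    omega
  · intro h
    by_contra! hr
    obtain ⟨v, hv⟩ := exists_linearIndependent_of_le_finrank (R := ℂ)
      (M := LinearMap.range M.mulVecLin) (n := r + 1) hr
    choose w hw using fun i => (v i).2
    let B : Matrix k (Fin (r + 1)) ℂ := of fun s i => w i s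
    have hcol : (M * B).col = fun i => (v i : m → ℂ) := by
      ext i s
      rw [← hw i]
      rfl
    have hli : LinearIndependent ℂ (M * B).col := by
      rw [hcol]
      exact hv.map' (Submodule.subtype _) (Submodule.ker_subtype _)
    obtain ⟨f, hf⟩ := LinearMap.exists_leftInverse_of_injective (toLin' (M * B))
      (LinearMap.ker_eq_bot.2 (mulVec_injective_iff.2 hli))
    have h1 : LinearMap.toMatrix' f * (M * B) = 1 := by
      rw [← LinearMap.toMatrix'_toLin' (M * B), ← LinearMap.toMatrix'_comp, hf,
        LinearMap.toMatrix'_id]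
    have h2 := h (LinearMap.toMatrix' f) B
    rw [Matrix.mul_assoc, h1, det_one] at h2
    exact one_ne_zero h2

theorem isClosed_rank_le {m k : Type*} [Fintype m] [Fintype k] {M : GL (Fin n) ℂ → Matrix m k ℂ}
    (hM : ∀ s i, (fun g => M g s i) ∈ glPolynomials n) (r : ℕ) :
    IsClosed[zariskiGL n] {g | (M g).rank ≤ r} := by
  classical
  convert isClosed_zeroLocus (A := {f | ∃ (A : Matrix (Fin (r + 1)) m ℂ)
    (B : Matrix k (Fin (r + 1)) ℂ), f = fun g => (A * M g * B).det}) ?_ using 1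
  · ext g
    rw [Set.mem_ofPred_eq, rank_le_iff_det_eq_zero]
    constructor
    · rintro h _ ⟨A, B, rfl⟩
      exact h A B
    · exact fun h A B => h _ ⟨A, B, rfl⟩
  · rintro _ ⟨A, B, rfl⟩
    have hentry : ∀ i j, (fun g => (A * M g * B) i j) ∈ glPolynomials n := by
      intro i j
      have : (fun g => (A * M g * B) i j) =
          ∑ l, ∑ s, (A i s * B l j) • fun g => M g s l := by
        ext g
        simp only [mul_apply, Finset.sum_apply, Pi.smul_apply, smul_eq_mul, Finset.sum_mul]
        refine Finset.sum_congr rfl fun l _ => Finset.sum_congr rfl fun s _ => ?_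
        ring
      rw [this]
      exact sum_mem fun l _ => sum_mem fun s _ => Subalgebra.smul_mem _ (hM _ _) _
    have hdet : (fun g => (A * M g * B).det) =
        ∑ σ : Equiv.Perm (Fin (r + 1)), ((Equiv.Perm.sign σ : ℤ) : ℂ) •
          ∏ i, fun g => (A * M g * B) (σ i) i := by
      ext g
      rw [det_apply', Finset.sum_apply]
      refine Finset.sum_congr rfl fun σ _ => ?_
      rw [Pi.smul_apply, smul_eq_mul, Finset.prod_apply]
    rw [hdet]
    exact sum_mem fun σ _ => Subalgebra.smul_mem _ (prod_mem fun i _ => hentry _ _) _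

namespace CompleteFlag

theorem isClosed_iff {C : Set (CompleteFlag n)} :
    IsClosed C ↔ IsClosed[zariskiGL n] {g | ofGL g ∈ C} :=
  isClosed_coinduced

theorem isClosed_finrank_map_sup_le (L₁ L₂ : (Fin n → ℂ) →ₗ[ℂ] (Fin n → ℂ)) (i j : Fin (n + 1))
    (r : ℕ) : IsClosed {F : CompleteFlag n |
      Module.finrank ℂ ↥((F.space i).map L₁ ⊔ (F.space j).map L₂) ≤ r} := by
  let w : GL (Fin n) ℂ → Fin n ⊕ Fin n → Fin n → ℂ := fun g => Sum.elim
    (fun k => if (k : ℕ) < i then L₁ ((g : Matrix (Fin n) (Fin n) ℂ).col k) else 0)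
    (fun k => if (k : ℕ) < j then L₂ ((g : Matrix (Fin n) (Fin n) ℂ).col k) else 0)
  have hspan : ∀ g, (((ofGL g).space i).map L₁ ⊔ ((ofGL g).space j).map L₂) =
      Submodule.span ℂ (Set.range (w g)) := by
    intro g
    refine le_antisymm (sup_le ?_ ?_) (Submodule.span_le.2 ?_)
    · rw [Submodule.map_le_iff_le_comap]
      refine ofGL_space_le fun k hk => Submodule.subset_span ⟨.inl k, ?_⟩
      simp [w, hk]
    · rw [Submodule.map_le_iff_le_comap]
      refine ofGL_space_le fun k hk => Submodule.subset_span ⟨.inr k, ?_⟩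
      simp [w, hk]
    · rintro _ ⟨k | k, rfl⟩
      · simp only [w, Sum.elim_inl]
        split_ifs with hk
        · exact Submodule.mem_sup_left (Submodule.mem_map_of_mem (col_mem_ofGL g hk))
        · exact zero_mem _
      · simp only [w, Sum.elim_inr]
        split_ifs with hk
        · exact Submodule.mem_sup_right (Submodule.mem_map_of_mem (col_mem_ofGL g hk))
        · exact zero_mem _
  have hL : ∀ (L : (Fin n → ℂ) →ₗ[ℂ] (Fin n → ℂ)) (s k : Fin n),
      (fun g : GL (Fin n) ℂ => L ((g : Matrix (Fin n) (Fin n) ℂ).col k) s) ∈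
        glPolynomials n := by
    intro L s k
    have : (fun g : GL (Fin n) ℂ => L ((g : Matrix (Fin n) (Fin n) ℂ).col k) s) =
        ∑ l, LinearMap.toMatrix' L s l • fun g : GL (Fin n) ℂ => g l k := by
      ext g
      rw [← LinearMap.toMatrix'_mulVec L, Finset.sum_apply]
      rfl
    rw [this]
    exact sum_mem fun l _ => Subalgebra.smul_mem _ (entry_mem_glPolynomials _ _) _
  rw [isClosed_iff]
  convert isClosed_rank_le (n := n) (M := fun g => (of (w g))ᵀ) ?_ r using 1
  · ext g
    rw [Set.mem_ofPred_eq, Set.mem_ofPred_eq, Set.mem_ofPred_eq, hspan, rank_eq_finrank_span_cols]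
    rfl
  · rintro s (k | k)
    · by_cases hk : (k : ℕ) < i
      · simpa [w, hk] using hL L₁ s k
      · convert zero_mem (glPolynomials n) using 1
        ext g
        simp [w, hk]
    · by_cases hk : (k : ℕ) < j
      · simpa [w, hk] using hL L₂ s k
      · convert zero_mem (glPolynomials n) using 1
        ext g
        simp [w, hk]

/-- If the flags obtained from those in `S` by changing one space lie in the closure of `S`, then
this closure is stable under changing that space. -/
theorem closure_stable {a b : Fin n} (hab : a ≠ b) (hb : (b : ℕ) = a + 1)
    {S : Set (CompleteFlag n)} (hS : ∀ g, ofGL g ∈ S → ∀ m, ofGL (g * colGL hab m) ∈ closure S)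
    {g : GL (Fin n) ℂ} (hg : ofGL g ∈ closure S) (m : GL (Fin 2) ℂ) :
    ofGL (g * colGL hab m) ∈ closure S := by
  -- The flags whose whole line lies in the closure of `S`. For fixed `m`, right multiplication by
  -- `colGL hab m` does not descend to flags, but the condition for all `m` does; pulled back to
  -- matrices, `D` is an intersection of closed sets. It contains `S`, hence its closure.
  let D : Set (CompleteFlag n) := {F | ∀ F' : CompleteFlag n,
    (∀ j : Fin (n + 1), (j : ℕ) ≠ b → F'.space j = F.space j) → F' ∈ closure S}
  have hD : ∀ g, ofGL g ∈ D ↔ ∀ m, ofGL (g * colGL hab m) ∈ closure S := by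
    intro g
    constructor
    · exact fun h m => h _ fun j hj => ofGL_mul_colGL_space g hab hb m hj
    · intro h F' hF'
      obtain ⟨m, rfl⟩ := exists_eq_ofGL_mul_colGL hab hb hF'
      exact h m
  have hclosed : IsClosed D := by
    rw [isClosed_iff]
    have : {g | ofGL g ∈ D} =
        ⋂ m, {g | g * colGL hab m ∈ {g | ofGL g ∈ closure S}} := by
      ext g
      rw [Set.mem_ofPred_eq, hD, Set.mem_iInter]
      rfl
    rw [this]
    exact @isClosed_iInter _ _ (zariskiGL n) _ fun m =>
      isClosed_preimage_mul_right (isClosed_iff.1 isClosed_closure) _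
  have hsub : closure S ⊆ D := closure_minimal (fun F hF => by
    obtain ⟨g, rfl⟩ := exists_ofGL F
    exact (hD g).2 (hS g hF)) hclosed
  exact (hD g).1 (hsub hg) m

end CompleteFlag

end Zariski

/-! ### The closure order. -/

theorem Submodule.finrank_map_add_finrank_inf {V : Type*} [AddCommGroup V] [Module ℂ V]
    [FiniteDimensional ℂ V] (L : V →ₗ[ℂ] V) (W : Submodule ℂ V) :
    Module.finrank ℂ ↥(W.map L) + Module.finrank ℂ ↥(W ⊓ LinearMap.ker L) =
      Module.finrank ℂ W := by
  rw [← LinearMap.range_domRestrict, ← LinearMap.finrank_range_add_finrank_ker (L.domRestrict W),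
    LinearMap.ker_domRestrict]
  congr 1
  rw [← Submodule.map_comap_subtype]
  exact Submodule.finrank_map_subtype_eq _ _

theorem ker_firstProj (p q : ℕ) : LinearMap.ker (firstProj p q) = lastSpace p q := by
  ext x
  rw [LinearMap.mem_ker, mem_lastSpace, funext_iff]
  refine forall_congr' fun r => ?_
  rw [firstProj_apply, Pi.zero_apply]
  constructor <;> intro h
  · linear_combination 2 * h
  · linear_combination (1 / 2 : ℂ) * h

theorem ker_id_sub_firstProj (p q : ℕ) :
    LinearMap.ker (LinearMap.id - firstProj p q) = firstSpace p q := by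
  ext x
  rw [LinearMap.mem_ker, mem_firstSpace, funext_iff]
  refine forall_congr' fun r => ?_
  rw [LinearMap.sub_apply, Pi.sub_apply, firstProj_apply, Pi.zero_apply, LinearMap.id_apply]
  constructor <;> intro h
  · linear_combination -2 * h
  · linear_combination (-1 / 2 : ℂ) * h

namespace Clan

variable {p q : ℕ} {γ τ τ' : Clan p q} {g : GL (Fin (p + q)) ℂ} {a b : Fin (p + q)}

theorem isClosed_le_finrank_inf_ker (L : (Fin (p + q) → ℂ) →ₗ[ℂ] (Fin (p + q) → ℂ))
    (i : Fin (p + q + 1)) (r : ℕ) : IsClosed {F : CompleteFlag (p + q) |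
      r ≤ Module.finrank ℂ ↥(F.space i ⊓ LinearMap.ker L)} := by
  have hdim : ∀ F : CompleteFlag (p + q), Module.finrank ℂ ↥((F.space i).map L) +
      Module.finrank ℂ ↥(F.space i ⊓ LinearMap.ker L) = i := fun F => by
    rw [Submodule.finrank_map_add_finrank_inf, F.finrank_space]
  -- By rank-nullity the condition is an upper bound `i - r` on the rank of `L` on `F_i`. If `r >
  -- i`, where the subtraction would truncate, no flag satisfies it.
  by_cases hr : r ≤ i
  · convert isClosed_finrank_map_sup_le L 0 i 0 (i - r) using 1
    ext F
    have := hdim F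
    rw [Set.mem_ofPred_eq, Set.mem_ofPred_eq, Submodule.map_zero, sup_bot_eq]
    omega
  · convert isClosed_empty using 1
    ext F
    have := hdim F
    rw [Set.mem_ofPred_eq, Set.mem_empty_iff_false, iff_false]
    omega

/-- Each inequality with ranks of `τ` cuts out a closed set of flags containing `Q_τ`, hence
contains a flag of `Q_γ`, where the ranks are those of `γ`. -/
theorem rankLE_of_closure_subset (h : closure γ.orbit ⊆ closure τ.orbit) : γ.RankLE τ := by
  obtain ⟨g, hg⟩ := γ.exists_adapted
  have hF : ofGL g ∈ γ.orbit := γ.adaptedFlags_subset_orbit ⟨g, hg, rfl⟩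
  have hmem : ∀ C : Set (CompleteFlag (p + q)), IsClosed C → τ.orbit ⊆ C → ofGL g ∈ C :=
    fun C hC hτ => closure_minimal hτ hC (h (subset_closure hF))
  refine (rankLE_iff _ _).2 ⟨fun i _ hi => ?_, fun i _ hi => ?_, fun i j _ hij hj => ?_⟩
  · have h1 := hmem _ (isClosed_le_finrank_inf_ker (LinearMap.id - firstProj p q) ⟨i, by omega⟩
      (τ.plusRank i)) fun F hF => by
        rw [Set.mem_ofPred_eq, ker_id_sub_firstProj, hF.1]
    rwa [Set.mem_ofPred_eq, ker_id_sub_firstProj, hF.1] at h1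
  · have h1 := hmem _ (isClosed_le_finrank_inf_ker (firstProj p q) ⟨i, by omega⟩
      (τ.minusRank i)) fun F hF => by
        rw [Set.mem_ofPred_eq, ker_firstProj, hF.2.1]
    rwa [Set.mem_ofPred_eq, ker_firstProj, hF.2.1] at h1
  · have hij' : (⟨i, by omega⟩ : Fin (p + q + 1)) < ⟨j, by omega⟩ := hij
    have h1 := hmem _ (isClosed_finrank_map_sup_le (firstProj p q) LinearMap.id ⟨i, by omega⟩
      ⟨j, by omega⟩ (j + τ.pairRank i j)) fun F hF => by
        rw [Set.mem_ofPred_eq, Submodule.map_id, hF.2.2 _ _ hij']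
    rw [Set.mem_ofPred_eq, Submodule.map_id, hF.2.2 _ _ hij'] at h1
    exact Nat.le_of_add_le_add_left h1

theorem Adapted.rankEqOff {γ' : Clan p q} (hg : γ.Adapted g) (hab : a ≠ b) (hb : (b : ℕ) = a + 1)
    {m : GL (Fin 2) ℂ} (hg' : γ'.Adapted (g * colGL hab m)) : γ'.RankEqOff b γ :=
  RankEqOff.of_orbit (γ'.adaptedFlags_subset_orbit ⟨_, hg', rfl⟩)
    (γ.adaptedFlags_subset_orbit ⟨_, hg, rfl⟩) fun _ hj => ofGL_mul_colGL_space g hab hb m hj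

/-- The lifting property of the rank order. -/
theorem RankLE.exists_adjacent (h : γ.RankLE τ) (hab : a ≠ b) (hb : (b : ℕ) = a + 1)
    (hτ : τ'.RankEqOff b τ) : ∃ γ' : Clan p q, γ'.RankLE τ' ∧
      ∃ m, ∀ g, γ.Adapted g → γ'.Adapted (g * colGL hab m) := by
  obtain ⟨g, hg⟩ := γ.exists_adapted
  have hself : γ.RankEqOff b γ := RankEqOff.refl _ _
  have hswap := hg.rankEqOff hab hb (hg.conj_swap hab)
  have one : ∀ g, γ.Adapted g → γ.Adapted (g * colGL hab 1) := fun g hg => by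
    rwa [map_one, mul_one]
  have swap : ∀ g, γ.Adapted g → (γ.conj (Equiv.swap a b)).Adapted
    (g * colGL hab (gl2 0 1 1 0 (by norm_num))) := fun g hg => hg.conj_swap hab
  -- Take `γ'` with an ascent at `a`, `b`: `γ` itself or its swap, or a splitting when `a` and `b`
  -- are mates. When opposite signs occur there are two candidates, and `of_opposite_signs` selects
  -- one.
  rcases lt_trichotomy (γ.perm a) (γ.perm b) with hasc | heq | hdesc
  · by_cases h1 : a ∈ γ.minus ∧ b ∈ γ.plus
    · rcases h.of_opposite_signs hb hτ hswap hself
        ((γ.mem_conj_plus _ _).2 (by rw [Equiv.swap_apply_left]; exact h1.2))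
        ((γ.mem_conj_minus _ _).2 (by rw [Equiv.swap_apply_right]; exact h1.1)) h1.1 h1.2 with h' | h'
      · exact ⟨_, h', _, swap⟩
      · exact ⟨_, h', _, one⟩
    by_cases h2 : a ∈ γ.plus ∧ b ∈ γ.minus
    · rcases h.of_opposite_signs hb hτ hself hswap h2.1 h2.2
        ((γ.mem_conj_minus _ _).2 (by rw [Equiv.swap_apply_left]; exact h2.2))
        ((γ.mem_conj_plus _ _).2 (by rw [Equiv.swap_apply_right]; exact h2.1)) with h' | h'
      · exact ⟨_, h', _, one⟩
      · exact ⟨_, h', _, swap⟩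
    exact ⟨γ, h.of_ascent hb hτ hself hasc h1 h2, _, one⟩
  · exact absurd (γ.perm.injective heq) hab
  · by_cases hpair : γ.perm a = b
    · have hpair' : γ.perm b = a := by rw [← hpair, γ.perm_perm]
      have ha : γ.perm a ≠ a := by rw [hpair]; exact hab.symm
      have hb' : γ.perm b ≠ b := by rw [hpair']; exact hab
      have hγa := hg.rankEqOff hab hb (hg.split_left hab hpair ha)
      have hγb := hg.rankEqOff hab hb (hg.split_right hab hpair hb')
      have h1 := mem_split_minus_right γ ha
      have h2 := mem_split_minus_right γ hb'
      rw [hpair] at h1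
      rw [hpair'] at h2
      rcases h.of_opposite_signs hb hτ hγa hγb (mem_split_plus_left γ ha) h1 h2
        (mem_split_plus_left γ hb') with h' | h'
      · exact ⟨_, h', _, fun g hg => hg.split_left hab hpair ha⟩
      · exact ⟨_, h', _, fun g hg => hg.split_right hab hpair hb'⟩
    · refine ⟨_, h.of_ascent hb hτ hswap ?_ ?_ ?_, _, swap⟩
      · rw [conj_perm_apply, conj_perm_apply, Equiv.swap_apply_left, Equiv.swap_apply_right,
          Equiv.swap_inv]
        refine Fin.swap_lt_swap hb hdesc fun hc => hpair hc.2
      · rintro ⟨h1, h2⟩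
        rw [mem_conj_minus, Equiv.swap_apply_left] at h1
        rw [mem_conj_plus, Equiv.swap_apply_right] at h2
        rw [γ.perm_plus a h2, (γ.mem_minus.1 h1).1, Fin.lt_def] at hdesc
        omega
      · rintro ⟨h1, h2⟩
        rw [mem_conj_plus, Equiv.swap_apply_left] at h1
        rw [mem_conj_minus, Equiv.swap_apply_right] at h2
        rw [γ.perm_plus b h1, (γ.mem_minus.1 h2).1, Fin.lt_def] at hdesc
        omega

/-- All but finitely many points of the line lie in `Q_τ`; the others are limits along a polynomial
curve. -/
theorem Adapted.colGL_mem_closure (hg : τ.Adapted g) (hab : a ≠ b) (hb : (b : ℕ) = a + 1)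
    (hdesc : τ.perm b < τ.perm a) (m : GL (Fin 2) ℂ) :
    ofGL (g * colGL hab m) ∈ closure τ.orbit := by
  -- The curve passes through `m` at `t = 0`. Its first column is that of `m` plus `t` times the
  -- second, so invertibility of `m` keeps it from lying identically in the exceptional locus.
  let c : ℂ → GL (Fin 2) ℂ := fun t => m * gl2 1 0 t 1 (by norm_num)
  have hc : ∀ t r, c t r 0 = m r 0 + t * m r 1 := by
    intro t r
    change ((m : Matrix (Fin 2) (Fin 2) ℂ) * !![1, 0; t, 1]) r 0 = _
    simp [mul_apply, Fin.sum_univ_two, mul_comm]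
  have hc1 : ∀ t r, c t r 1 = m r 1 := by
    intro t r
    change ((m : Matrix (Fin 2) (Fin 2) ℂ) * !![1, 0; t, 1]) r 1 = _
    simp [mul_apply, Fin.sum_univ_two]
  have hdet : m 0 0 * m 1 1 - m 0 1 * m 1 0 ≠ 0 := by
    have := (isUnit_iff_isUnit_det _).1 m.isUnit
    rw [det_fin_two] at this
    exact this.ne_zero
  have hpoly : ∀ r k, ∃ P : Polynomial ℂ, ∀ t, (g * colGL hab (c t)) r k = P.eval t := by
    intro r k
    refine ⟨if k = a then Polynomial.C (g r a * m 0 0 + g r b * m 1 0) +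
      Polynomial.C (g r a * m 0 1 + g r b * m 1 1) * Polynomial.X
      else if k = b then Polynomial.C (g r a * m 0 1 + g r b * m 1 1)
      else Polynomial.C (g r k), fun t => ?_⟩
    rw [mul_colGL_apply, hc, hc, hc1, hc1]
    split_ifs <;> simp
    ring
  have hlin : ∀ x y : ℂ, x ≠ 0 ∨ y ≠ 0 →
      (Polynomial.C x + Polynomial.C y * Polynomial.X : Polynomial ℂ) ≠ 0 := by
    intro x y hxy h0
    have e0 := congrArg (fun P : Polynomial ℂ => P.coeff 0) h0
    have e1 := congrArg (fun P : Polynomial ℂ => P.coeff 1) h0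
    simp [Polynomial.coeff_C] at e0 e1
    exact hxy.elim (· e0) (· e1)
  have hgen : ∃ d : Polynomial ℂ, d ≠ 0 ∧
      ∀ t, d.eval t ≠ 0 → ofGL (g * colGL hab (c t)) ∈ closure τ.orbit := by
    by_cases hpair : τ.perm a = b
    · refine ⟨(Polynomial.C (m 0 0 - m 1 0) + Polynomial.C (m 0 1 - m 1 1) * Polynomial.X) *
        (Polynomial.C (m 0 0 + m 1 0) + Polynomial.C (m 0 1 + m 1 1) * Polynomial.X),
        mul_ne_zero (hlin _ _ ?_) (hlin _ _ ?_), fun t ht => ?_⟩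
      · by_contra! h0
        exact hdet (by linear_combination m 1 1 * h0.1 - m 1 0 * h0.2)
      · by_contra! h0
        exact hdet (by linear_combination m 1 1 * h0.1 - m 1 0 * h0.2)
      · refine subset_closure (τ.adaptedFlags_subset_orbit
          (hg.colGL_mem_of_pair hab hb hpair fun h0 => ht ?_))
        rw [hc, hc] at h0
        simp only [Polynomial.eval_mul, Polynomial.eval_add, Polynomial.eval_C, Polynomial.eval_X]
        linear_combination h0
    · refine ⟨Polynomial.C (m 0 0) + Polynomial.C (m 0 1) * Polynomial.X, hlin _ _ ?_,
        fun t ht => ?_⟩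
      · by_contra! h0
        exact hdet (by linear_combination m 1 1 * h0.1 - m 1 0 * h0.2)
      · refine subset_closure (τ.adaptedFlags_subset_orbit
          (hg.colGL_mem_of_descent hab hb hdesc hpair fun h0 => ht ?_))
        rw [hc] at h0
        simp only [Polynomial.eval_mul, Polynomial.eval_add, Polynomial.eval_C, Polynomial.eval_X]
        linear_combination h0
  obtain ⟨d, hd, hd'⟩ := hgen
  have h0 := mem_of_curve (isClosed_iff.1 (isClosed_closure (s := τ.orbit))) hpoly hd hd' 0
  have hc0 : c 0 = m := by
    refine Units.ext (Matrix.ext fun r k => ?_)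
    fin_cases k
    · exact (hc 0 r).trans (by simp)
    · exact hc1 0 r
  rwa [Set.mem_ofPred_eq, hc0] at h0

/-- The inductive step: a closure containing the flags adapted to an adjacent smaller clan `τ'`
contains all the orbits below `τ` if the closure of the orbit of `τ'` contains those below `τ'`. -/
theorem orbit_subset_closure_step (hab : a ≠ b) (hb : (b : ℕ) = a + 1)
    (hdesc : τ.perm b < τ.perm a) {m : GL (Fin 2) ℂ}
    (hτ : ∀ g, τ'.Adapted g → τ.Adapted (g * colGL hab m))
    (ih : ∀ γ : Clan p q, γ.RankLE τ' → γ.orbit ⊆ closure τ'.orbit) (h : γ.RankLE τ) :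
    γ.orbit ⊆ closure τ.orbit := by
  have hback : ∀ (g : GL (Fin (p + q)) ℂ) (m : GL (Fin 2) ℂ),
      g * colGL hab m * colGL hab m⁻¹ = g := fun g m => by
    rw [map_inv, mul_inv_cancel_right]
  -- Every `τ'`-adapted flag lies on a line through a `τ`-adapted flag, and `τ` has a descent there.
  have hsub : closure τ'.orbit ⊆ closure τ.orbit := by
    refine closure_minimal ?_ isClosed_closure
    rw [orbit_eq_adaptedFlags τ']
    rintro _ ⟨g, hg, rfl⟩
    rw [← hback g m]
    exact (hτ g hg).colGL_mem_closure hab hb hdesc m⁻¹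
  obtain ⟨g₀, hg₀⟩ := τ'.exists_adapted
  have hoff : τ'.RankEqOff b τ :=
    (hτ g₀ hg₀).rankEqOff hab hb (m := m⁻¹) (by rwa [hback])
  obtain ⟨γ', hγ', m', hm'⟩ := h.exists_adjacent hab hb hoff
  rw [orbit_eq_adaptedFlags γ]
  rintro _ ⟨g, hg, rfl⟩
  rw [← hback g m']
  -- The line through a flag of `Q_γ` meets `Q_γ'`, which lies in the closure of `Q_τ`; stability
  -- along lines carries this back to the given flag.
  refine closure_stable hab hb (fun g' hg' m => ?_)
    (hsub (ih γ' hγ' (γ'.adaptedFlags_subset_orbit ⟨_, hm' g hg, rfl⟩))) m'⁻¹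
  rw [orbit_eq_adaptedFlags τ] at hg'
  obtain ⟨g'', hg'', he⟩ := hg'
  obtain ⟨m'', hm''⟩ := exists_eq_ofGL_mul_colGL hab hb (g := g'') (F := ofGL (g' * colGL hab m))
    fun j hj => by rw [ofGL_mul_colGL_space g' hab hb m hj, he]
  rw [hm'']
  exact hg''.colGL_mem_closure hab hb hdesc m''

/-- In each inductive case the matrix `m` passes from the simpler clan back to `τ`: an exchange of
columns undoes the swap, and the sum and difference of columns rejoin the split pair. -/
theorem RankLE.orbit_subset_closure (h : γ.RankLE τ) : γ.orbit ⊆ closure τ.orbit := by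
  induction τ using descent_induction generalizing γ with
  | one τ hτ =>
    rw [h.eq_of_perm_eq_one hτ]
    exact subset_closure
  | conj_swap τ a b hb hdesc hne ih =>
    have hab : a ≠ b := by
      rintro rfl
      omega
    refine orbit_subset_closure_step (m := gl2 0 1 1 0 (by norm_num)) hab hb hdesc (fun g hg => ?_) (fun γ h => ih h) h
    have := hg.conj_swap hab
    rwa [conj_swap_conj_swap] at this
  | split τ a b hb hpair ha ih =>
    subst hpair
    refine orbit_subset_closure_step (m := gl2 1 1 1 (-1) (by norm_num)) ha.symm hb ?_
      (fun g hg => ?_) (fun γ h => ih h) h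
    · rw [τ.perm_perm, Fin.lt_def]
      omega
    · exact hg.of_split ha

end Clan

theorem theorem1p2 (p q : ℕ) :
    (∀ γ : Clan p q, ∃ F : CompleteFlag (p + q),
      γ.orbit = MulAction.orbit (blockSubgroup p q) F) ∧
    (∀ γ τ : Clan p q,
      closure γ.orbit ⊆ closure τ.orbit ↔
        (∀ i : ℕ, 1 ≤ i → i ≤ p + q → γ.plusRank i ≥ τ.plusRank i) ∧
        (∀ i : ℕ, 1 ≤ i → i ≤ p + q → γ.minusRank i ≥ τ.minusRank i) ∧
        (∀ i j : ℕ, 1 ≤ i → i < j → j ≤ p + q → γ.pairRank i j ≤ τ.pairRank i j)) := by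
  refine ⟨fun γ => ?_, fun γ τ => ?_⟩
  · obtain ⟨g, hg⟩ := γ.exists_adapted
    exact ⟨ofGL g, by rw [γ.orbit_eq_adaptedFlags, Clan.adaptedFlags_eq_orbit hg]⟩
  · rw [← Clan.rankLE_iff]
    exact ⟨Clan.rankLE_of_closure_subset,
      fun h => closure_minimal h.orbit_subset_closure isClosed_closure⟩
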